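/- \textbf{Setting.} The Parikh image of a word over a finite alphabet $\Sigma$ is the vector in $\mathbb{N}^{\Sigma}$ that counts the occurrences of each letter; the Parikh image of a language is the set of the Parikh images of its words. A one-counter automaton (OCA) is a nondeterministic finite automaton (possibly with $\varepsilon$-moves) equipped with a counter that holds a nonnegative integer, initially $0$; a transition may increment the counter, decrement it (if it is positive), leave it unchanged, or test it for zero, and a word is accepted if some run on it ends in a final state. The size of an OCA is its number of states plus the size of its alphabet plus its number of transitions. An OCA and an NFA over the same alphabet are Parikh-equivalent if their languages have the same Parikh image. For an even integer $n\ge 2$, the universal one-counter set $U_n$ is the set of vectors $(y_{ij},x_i)=(y_{ij}: 0\le i<j<n;\ x_i: 0\le i<n)$ of nonnegative integers, regarded as Parikh images over the alphabet $\{c_{ij}:0\le i<j<n\}\cup\{a_i:0\le i<n\}$ (with $y_{ij}$ counting $c_{ij}$ and $x_i$ counting $a_i$), such that: (1) $y_{ij}\in\{0,1\}$, and the pairs $(i,j)$ with $y_{ij}=1$ are precisely the edges of a monotone directed path from $0$ to $n-1$; (2) $\sum_{i=0}^{n-1}(-1)^i x_i=0$, and $\sum_{i=0}^{k}(-1)^i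 x_i\ge 0$ for all $0\le k<n-1$; (3) if $x_j>0$ and $j>0$, then $y_{ij}=1$ for some $i$; if $x_j>0$ and $j<n-1$, then $y_{jk}=1$ for some $k$. \textbf{Corollary.} (a) Every NFA that recognizes a language with Parikh image $U_n$ has $n^{\Omega(\sqrt{\log n/\log\log n})}$ states; that is, there are a constant $c>0$ and an integer $N$ such that for every even $n\ge N$ every such NFA has at least $n^{c\sqrt{\log n/\log\log n}}$ states. (b) For every even $n\ge 2$, $U_n$ is the Parikh image of a language recognized by an OCA with $n+2$ states. Consequently there is no polynomial translation from OCA to Parikh-equivalent NFA: there is no polynomial $P$ such that every OCA of size $s$ has a Parikh-equivalent NFA with at most $P(s)$ states. -/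

import Mathlib

/-- The Parikh image of a word: how many times each letter occurs in it. -/
def parikhVector {α : Type} [DecidableEq α] (w : List α) : α → ℕ := fun a => w.count a

/-- The Parikh image of a language: the set of the Parikh images of its words. -/
def parikhImage {α : Type} [DecidableEq α] (L : Language α) : Set (α → ℕ) :=
  {v | ∃ w ∈ L, parikhVector w = v}

/-- Operations of a one-counter automaton on its counter. -/
inductive CounterOp where
  | inc
  | dec
  | nop
  | zeroTest

/-- `o.Step c d`: the operation `o` can be performed at counter value `c`, and changes it to `d`.
The counter stays nonnegative: `dec` is blocked at `0`. -/
def CounterOp.Step : CounterOp → ℕ → ℕ → Prop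
  | .inc, c, d => d = c + 1
  | .dec, c, d => c = d + 1
  | .nop, c, d => d = c
  | .zeroTest, c, d => c = 0 ∧ d = 0

/-- A (nondeterministic) one-counter automaton over the alphabet `α` with set of states `Q`.
A transition `(q, a, o, q')` leads from `q` to `q'`, reads the letter `a` (nothing if `a = none`)
and performs `o` on the counter. -/
structure OCA (α Q : Type) where
  /-- the transitions -/
  trans : Finset (Q × Option α × CounterOp × Q)
  /-- the initial state -/
  start : Q
  /-- the final states -/
  accept : Set Q

namespace OCA

variable {α Q : Type}

/-- `A.Run q c w r d`: there is a run of `A` from state `q` with counter value `c` to state `r`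
with counter value `d` that reads the word `w`. -/
inductive Run (A : OCA α Q) : Q → ℕ → List α → Q → ℕ → Prop
  | nil (q : Q) (c : ℕ) : Run A q c [] q c
  | cons (q q' r : Q) (c c' d : ℕ) (a : Option α) (o : CounterOp) (w : List α) :
      (q, a, o, q') ∈ A.trans → o.Step c c' → Run A q' c' w r d →
        Run A q c (a.toList ++ w) r d

/-- The language recognized by `A`: the words read by the runs that start in the initial state with
counter value `0` and end in a final state. -/
def accepts (A : OCA α Q) : Language α :=
  {w | ∃ q ∈ A.accept, ∃ d : ℕ, A.Run A.start 0 w q d}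

/-- The description size of `A`: number of states, plus number of letters, plus number of
transitions. -/
def size [Fintype α] [Fintype Q] (A : OCA α Q) : ℕ :=
  Fintype.card Q + Fintype.card α + A.trans.card

end OCA

/-- The alphabet `{c_{ij} : 0 ≤ i < j < n} ∪ {a_i : 0 ≤ i < n}`. -/
abbrev UnivLetter (n : ℕ) : Type := {p : Fin n × Fin n // p.1 < p.2} ⊕ Fin n

/-- The letter `c_{ij}`. -/
def letterC {n : ℕ} (i j : Fin n) (h : i < j) : UnivLetter n := Sum.inl ⟨(i, j), h⟩

/-- The letter `a_i`. -/
def letterA {n : ℕ} (i : Fin n) : UnivLetter n := Sum.inr i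

/-- The components `y_{ij}` are `0` or `1`, and the edges `(i, j)` with `y_{ij} = 1` are exactly
the edges of a monotone path `p 0 < p 1 < ⋯ < p t` from `0` to `n - 1`. -/
def IsChainVector {n : ℕ} (v : UnivLetter n → ℕ) : Prop :=
  (∀ (i j : Fin n) (h : i < j), v (letterC i j h) = 0 ∨ v (letterC i j h) = 1) ∧
  ∃ (t : ℕ) (p : Fin (t + 1) → Fin n), StrictMono p ∧
    (p 0 : ℕ) = 0 ∧ (p (Fin.last t) : ℕ) + 1 = n ∧
    ∀ (i j : Fin n) (h : i < j),
      v (letterC i j h) = 1 ↔ ∃ s : Fin t, p s.castSucc = i ∧ p s.succ = j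

/-- Balance: the alternating sum of all the `x_i` is `0`, and the alternating sum of
`x_0, …, x_k` is nonnegative for each `k < n - 1`. -/
def IsBalanced {n : ℕ} (v : UnivLetter n → ℕ) : Prop :=
  ∑ i : Fin n, (-1 : ℤ) ^ (i : ℕ) * (v (letterA i) : ℤ) = 0 ∧
  ∀ k : Fin n, (k : ℕ) + 1 < n →
    0 ≤ ∑ i ∈ Finset.Iic k, (-1 : ℤ) ^ (i : ℕ) * (v (letterA i) : ℤ)

/-- Compatibility: if `x_j > 0`, then the chain has an edge into `j` (unless `j = 0`) and an edge
out of `j` (unless `j = n - 1`). -/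
def IsCompatible {n : ℕ} (v : UnivLetter n → ℕ) : Prop :=
  ∀ j : Fin n, 0 < v (letterA j) →
    (0 < (j : ℕ) → ∃ (i : Fin n) (h : i < j), v (letterC i j h) = 1) ∧
    ((j : ℕ) + 1 < n → ∃ (k : Fin n) (h : j < k), v (letterC j k h) = 1)

/-- The universal one-counter set `U_n`. -/
def universalOneCounterSet (n : ℕ) : Set (UnivLetter n → ℕ) :=
  {v | IsChainVector v ∧ IsBalanced v ∧ IsCompatible v}

/-! Lower bound. Take a bracket word σ of length m that is balanced and never dips below 0, and
reserve a block of 2Q integers for each bracket: the even ones are candidate nodes for an opening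
bracket, the odd ones for a closing one. Choosing a node in every block gives Q^m chains, and giving
all inner nodes the same multiplicity N yields vectors of U_n. Cut an accepted word for such a
vector into windows. Each window runs between two states of an accepting run, so boundedly many
extra letters complete it to an accepted word; hence its alternating suffix sums are bounded above.
By Hall's theorem (`exists_rePairing`) the brackets can be matched inside common windows, a
different window for each pair, and the order of the windows gives a re-pairing of σ.

Suppose that every re-pairing of σ has a moment at which erased and remaining brackets alternate
often. Cutting the word at the corresponding window leaves many nodes touched by both sides. If two
words are cut at the same state, the prefix of one and the suffix of the other form an accepted
word, whose vector must again describe a single path; so the two chains agree at every level where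
the prefix touches the first chain and the suffix the second (`nodeFin_eq_of_mixed`). A state
together with a set of A such levels thus fixes A coordinates of the chain, and counting gives Q^A ≤
|S| m^A (`pow_le_card_mul_pow`).

Hard words (`RePairing.exists_alternations`). Level j + 1 consists of C copies of level j, each
followed by a tall block that goes up or down in turn. Suppose that level j + 1 never has more than
j + 1 alternations. When one copy has j + 1 of them, all symbols on its left have the same status,
and so have all on its right. This forces the copies to reach their moments in a sweep from one end
to the other (`sweep_dichotomy`). During a sweep the balance of the erased symbols oscillates with
the blocks, and each oscillation erases a pair that crosses the boundary of the factor. There are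
more oscillations than the heights at the boundary allow such pairs. The length is at most
(2j+2)^((j+2)(j+1)), so j can be of order √(log n / log log n).

Upper bound. The automaton walks along the chain, reads letters a_i at node i while counting up or
down by the parity of i, and tests for zero at n - 1. Its size is polynomial in n, while the lower
bound is superpolynomial. -/

/-! ### Re-pairings, crossing pairs and erased balance -/

/-- A re-pairing of the bracket word `σ 0, …, σ (m - 1)` (with `1` for an opening and `-1` for a
closing bracket): `π` pairs each opening bracket with a closing bracket to its right, and the pairs
are erased one after another, the pair of `i` at time `τ i`. -/
structure RePairing (σ : ℕ → ℤ) (m : ℕ) (π τ : ℕ → ℕ) : Prop where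
  sigma : ∀ i < m, σ i = 1 ∨ σ i = -1
  lt : ∀ i < m, π i < m
  invol : ∀ i < m, π (π i) = i
  sign : ∀ i < m, σ (π i) = -σ i
  right : ∀ i < m, σ i = 1 → i < π i
  time_pair : ∀ i < m, τ (π i) = τ i
  time_inj : ∀ i < m, ∀ j < m, τ i = τ j → j = i ∨ j = π i

/-- The number of positions in the factor of length `l` at `a` where an erased symbol is next to
one that is not erased, at time `r`. -/
def alternations (τ : ℕ → ℕ) (r a l : ℕ) : ℕ :=
  ((Finset.range (l - 1)).filter fun i => ¬(τ (a + i) < r ↔ τ (a + i + 1) < r)).card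

/-- The height of the word `σ` after `i` symbols. -/
def height (σ : ℕ → ℤ) (i : ℕ) : ℤ := ∑ x ∈ Finset.range i, σ x

/-- The balance of the erased symbols of the factor `[a, b)` at time `r`. -/
def erasedNet (σ : ℕ → ℤ) (τ : ℕ → ℕ) (a b r : ℕ) : ℤ :=
  ∑ i ∈ (Finset.Ico a b).filter (fun i => τ i < r), σ i

namespace RePairing

variable {σ : ℕ → ℤ} {m : ℕ} {π τ : ℕ → ℕ}

theorem sum_paired (h : RePairing σ m π τ) (T : Finset ℕ) (hT : ∀ i ∈ T, i < m)
    (hp : ∀ i ∈ T, π i ∈ T) : ∑ i ∈ T, σ i = 0 := by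
  refine Finset.sum_involution (fun i _ => π i) ?_ ?_ hp ?_
  · intro i hi
    rw [h.sign i (hT i hi)]; ring
  · intro i hi hne heq
    have h1 := h.sign i (hT i hi)
    rw [heq] at h1
    apply hne; linarith
  · intro i hi
    exact h.invol i (hT i hi)

/-- Pairs inside the prefix cancel, and a pair that crosses its end has its opening bracket on the
left, so each one contributes 1 to the height. -/
theorem card_crossing (h : RePairing σ m π τ) {a : ℕ} (ha : a ≤ m) :
    (((Finset.range a).filter fun i => a ≤ π i).card : ℤ) = height σ a := by
  unfold height
  rw [← Finset.sum_filter_add_sum_filter_not (Finset.range a) (fun i => a ≤ π i)]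
  rw [h.sum_paired ((Finset.range a).filter fun i => ¬ a ≤ π i)]
  · rw [Finset.card_eq_sum_ones, Nat.cast_sum, add_zero]
    refine Finset.sum_congr rfl ?_
    intro i hi
    simp only [Finset.mem_filter, Finset.mem_range] at hi
    have him : i < m := by omega
    rcases h.sigma i him with h1 | h1
    · simp [h1]
    · have h2 := h.right (π i) (h.lt i him) (by rw [h.sign i him, h1]; norm_num)
      rw [h.invol i him] at h2
      omega
  · intro i hi
    simp only [Finset.mem_filter, Finset.mem_range] at hi
    omega
  · intro i hi
    simp only [Finset.mem_filter, Finset.mem_range] at hi ⊢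
    rw [h.invol i (by omega)]
    omega

theorem card_boundary (h : RePairing σ m π τ) {a b : ℕ} (hab : a ≤ b) (hb : b ≤ m) :
    (((Finset.Ico a b).filter fun i => ¬(a ≤ π i ∧ π i < b)).card : ℤ) ≤
      height σ a + height σ b := by
  rw [← h.card_crossing (hab.trans hb), ← h.card_crossing hb]
  norm_cast
  rw [← Finset.card_filter_add_card_filter_not (s := (Finset.Ico a b).filter _)
    (fun i => π i < a)]
  gcongr ?_ + ?_
  · refine Finset.card_le_card_of_injOn π ?_ ?_
    · intro i hi
      simp only [Finset.coe_filter, Finset.mem_filter, Finset.mem_Ico, Finset.mem_range,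
        Set.mem_ofPred_eq] at hi ⊢
      rw [h.invol i (by omega)]
      omega
    · intro i hi j hj hij
      simp only [Finset.coe_filter, Finset.mem_filter, Finset.mem_Ico,
        Set.mem_ofPred_eq] at hi hj
      rw [← h.invol i (by omega), hij, h.invol j (by omega)]
  · apply Finset.card_le_card
    intro i hi
    simp only [Finset.mem_filter, Finset.mem_Ico, Finset.mem_range] at hi ⊢
    omega

/-- Between the two times only pairs with both ends inside the factor are erased there, and each of
them has balance 0. -/
theorem erasedNet_eq (h : RePairing σ m π τ) {a b r r' : ℕ} (hb : b ≤ m) (hr : r ≤ r')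
    (hX : ∀ i ∈ (Finset.Ico a b).filter (fun i => ¬(a ≤ π i ∧ π i < b)), ¬(r ≤ τ i ∧ τ i < r')) :
    erasedNet σ τ a b r = erasedNet σ τ a b r' := by
  unfold erasedNet
  rw [← Finset.sum_filter_add_sum_filter_not ((Finset.Ico a b).filter (fun i => τ i < r'))
    (fun i => τ i < r)]
  rw [h.sum_paired (((Finset.Ico a b).filter (fun i => τ i < r')).filter fun i => ¬ τ i < r)]
  · rw [add_zero]
    congr 1
    ext i
    simp only [Finset.mem_filter, Finset.mem_Ico]
    omega
  · intro i hi
    simp only [Finset.mem_filter, Finset.mem_Ico] at hi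
    omega
  · intro i hi
    simp only [Finset.mem_filter, Finset.mem_Ico] at hi ⊢
    have h1 := hX i
    simp only [Finset.mem_filter, Finset.mem_Ico] at h1
    rw [h.time_pair i (by omega)]
    omega

end RePairing

/-- Summation by parts: erasing a part of a word that starts and ends at height `0`. -/
theorem abs_sum_erased_le (e : ℕ → Prop) [DecidablePred e] (s : ℕ → ℤ) (G : ℤ) (l : ℕ)
    (h0 : ∀ i ≤ l, 0 ≤ height s i) (hG : ∀ i ≤ l, height s i ≤ G) (hl : height s l = 0) :
    |∑ i ∈ Finset.range l, if e i then s i else 0| ≤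
      ((Finset.range (l - 1)).filter fun i => ¬(e i ↔ e (i + 1))).card * G := by
  -- A maximal erased stretch contributes a difference of two heights. Subtracting the height of a
  -- stretch that is still open leaves a quantity that changes only at alternations, each time by a
  -- height between 0 and G.
  have key : ∀ k, k + 1 ≤ l →
      |(∑ i ∈ Finset.range (k + 1), if e i then s i else 0) -
        (if e k then height s (k + 1) else 0)| ≤
      ((Finset.range k).filter fun i => ¬(e i ↔ e (i + 1))).card * G := by
    intro k
    induction k with
    | zero =>
      intro _
      simp [height]
    | succ k ih =>
      intro hk
      have ih' := ih (by omega)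
      rw [Finset.sum_range_succ]
      generalize (∑ i ∈ Finset.range (k + 1), if e i then s i else 0) = Z at ih' ⊢
      rw [Finset.range_add_one, Finset.filter_insert]
      have hs : height s (k + 1 + 1) = height s (k + 1) + s (k + 1) := by
        unfold height; rw [Finset.sum_range_succ]
      have b0 := h0 (k + 1) (by omega)
      have bG := hG (k + 1) (by omega)
      rw [hs]
      rw [abs_le] at ih' ⊢
      by_cases h1 : e k <;> by_cases h2 : e (k + 1) <;> simp [h1, h2] at ih' ⊢ <;>
        constructor <;> nlinarith
  rcases Nat.eq_zero_or_pos l with rfl | hpos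
  · simp
  · obtain ⟨k, rfl⟩ : ∃ k, l = k + 1 := ⟨l - 1, by omega⟩
    have := key k le_rfl
    simpa [hl] using this

/-! ### The hard words and their heights -/

section HardWord

/-- The length of the hard word of level `j`. -/
def wordLen (M C : ℕ) : ℕ → ℕ
  | 0 => 4
  | j + 1 => C * (wordLen M C j + M * (M + 1) ^ j)

/-- The hard word of level `j + 1` consists of `C` cells. Each cell is the hard word of level `j`
followed by a block of brackets, which are opening in the even cells and closing in the odd ones. -/
def hardWord (M C : ℕ) : ℕ → ℕ → ℤ
  | 0, i => if i % 2 = 0 then 1 else -1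
  | j + 1, i =>
    if i % (wordLen M C j + M * (M + 1) ^ j) < wordLen M C j then
      hardWord M C j (i % (wordLen M C j + M * (M + 1) ^ j))
    else if i / (wordLen M C j + M * (M + 1) ^ j) % 2 = 0 then 1 else -1

variable {M C : ℕ}

theorem wordLen_pos (hC : 0 < C) (j : ℕ) : 0 < wordLen M C j := by
  induction j with
  | zero => simp [wordLen]
  | succ j ih => simp only [wordLen]; positivity

theorem hardWord_sign (j i : ℕ) : hardWord M C j i = 1 ∨ hardWord M C j i = -1 := by
  induction j generalizing i with
  | zero => simp only [hardWord]; split_ifs <;> simp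
  | succ j ih => simp only [hardWord]; split_ifs <;> first | exact ih _ | simp

theorem hardWord_succ_copy {j c x : ℕ} (hx : x < wordLen M C j) :
    hardWord M C (j + 1) (c * (wordLen M C j + M * (M + 1) ^ j) + x) = hardWord M C j x := by
  have h1 : (c * (wordLen M C j + M * (M + 1) ^ j) + x) % (wordLen M C j + M * (M + 1) ^ j) = x := by
    rw [mul_comm, Nat.mul_add_mod, Nat.mod_eq_of_lt (by omega)]
  simp only [hardWord, h1, if_pos hx]

theorem hardWord_succ_block {j c x : ℕ} (hx : x < M * (M + 1) ^ j) :
    hardWord M C (j + 1) (c * (wordLen M C j + M * (M + 1) ^ j) + (wordLen M C j + x)) =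
      if c % 2 = 0 then 1 else -1 := by
  have hlt : wordLen M C j + x < wordLen M C j + M * (M + 1) ^ j := by omega
  have h1 : (c * (wordLen M C j + M * (M + 1) ^ j) + (wordLen M C j + x)) %
      (wordLen M C j + M * (M + 1) ^ j) = wordLen M C j + x := by
    rw [mul_comm, Nat.mul_add_mod, Nat.mod_eq_of_lt hlt]
  have h2 : (c * (wordLen M C j + M * (M + 1) ^ j) + (wordLen M C j + x)) /
      (wordLen M C j + M * (M + 1) ^ j) = c := by
    rw [mul_comm, Nat.mul_add_div (by omega), Nat.div_eq_of_lt hlt, add_zero]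
  simp only [hardWord, h1, h2]
  rw [if_neg (by omega)]

theorem height_add (σ : ℕ → ℤ) (a i : ℕ) :
    height σ (a + i) = height σ a + height (fun x => σ (a + x)) i := by
  unfold height
  rw [Finset.sum_range_add]

theorem height_congr {σ ρ : ℕ → ℤ} {i : ℕ} (h : ∀ x < i, σ x = ρ x) :
    height σ i = height ρ i :=
  Finset.sum_congr rfl fun x hx => h x (Finset.mem_range.1 hx)

theorem height_const (z : ℤ) (i : ℕ) : height (fun _ => z) i = i * z := by
  simp [height]

theorem height_copy {j c x : ℕ} (hx : x ≤ wordLen M C j) :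
    height (hardWord M C (j + 1)) (c * (wordLen M C j + M * (M + 1) ^ j) + x) =
      height (hardWord M C (j + 1)) (c * (wordLen M C j + M * (M + 1) ^ j)) +
        height (hardWord M C j) x := by
  rw [height_add]
  congr 1
  exact height_congr fun y hy => hardWord_succ_copy (by omega)

theorem height_block {j c x : ℕ} (hx : x ≤ M * (M + 1) ^ j) :
    height (hardWord M C (j + 1))
        (c * (wordLen M C j + M * (M + 1) ^ j) + (wordLen M C j + x)) =
      height (hardWord M C (j + 1)) (c * (wordLen M C j + M * (M + 1) ^ j)) +
        height (hardWord M C j) (wordLen M C j) + x * (if c % 2 = 0 then 1 else -1) := by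
  rw [← add_assoc, height_add, height_copy le_rfl]
  congr 1
  rw [← height_const]
  exact height_congr fun y hy => by
    rw [add_assoc]; exact hardWord_succ_block (by omega)

theorem height_cell {j : ℕ} (h0 : height (hardWord M C j) (wordLen M C j) = 0) (c : ℕ) :
    height (hardWord M C (j + 1)) (c * (wordLen M C j + M * (M + 1) ^ j)) =
      ((c % 2 : ℕ) : ℤ) * (M * (M + 1) ^ j : ℕ) := by
  induction c with
  | zero => simp [height]
  | succ c ih =>
    have h1 : (c + 1) * (wordLen M C j + M * (M + 1) ^ j) =
        c * (wordLen M C j + M * (M + 1) ^ j) + (wordLen M C j + M * (M + 1) ^ j) := by ring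
    rw [h1, height_block le_rfl, ih, h0]
    rcases Nat.mod_two_eq_zero_or_one c with h | h
    · have : (c + 1) % 2 = 1 := by omega
      simp [h, this]
    · have : (c + 1) % 2 = 0 := by omega
      simp [h, this]

/-- A cell starts at height 0 or M(M+1)^j; its copy rises by at most (M+1)^j above that, and its
block leads to the other of the two levels. The maximum is M(M+1)^j + (M+1)^j = (M+1)^(j+1). -/
theorem height_hardWord (hC : C % 2 = 0) (j : ℕ) :
    (∀ i ≤ wordLen M C j, 0 ≤ height (hardWord M C j) i ∧
      height (hardWord M C j) i ≤ ((M + 1) ^ j : ℕ)) ∧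
    height (hardWord M C j) (wordLen M C j) = 0 := by
  induction j with
  | zero =>
    simp only [wordLen]
    refine ⟨?_, by simp [height, Finset.sum_range_succ, hardWord]⟩
    intro i hi
    interval_cases i <;> simp [height, Finset.sum_range_succ, hardWord]
  | succ j ih =>
    obtain ⟨ih1, ih2⟩ := ih
    refine ⟨?_, by simp only [wordLen]; rw [height_cell ih2, hC]; simp⟩
    intro i hip
    simp only [wordLen] at hip
    set p := wordLen M C j + M * (M + 1) ^ j with hp
    have hpow : (((M + 1) ^ (j + 1) : ℕ) : ℤ) = (M * (M + 1) ^ j : ℕ) + ((M + 1) ^ j : ℕ) := by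
      push_cast; ring
    have hi := Nat.div_add_mod i p
    have hg : (0 : ℤ) ≤ (M * (M + 1) ^ j : ℕ) := by positivity
    have hG : (0 : ℤ) ≤ ((M + 1) ^ j : ℕ) := by positivity
    have hc : (((i / p) % 2 : ℕ) : ℤ) = 0 ∨ (((i / p) % 2 : ℕ) : ℤ) = 1 := by
      rcases Nat.mod_two_eq_zero_or_one (i / p) with h | h <;> simp [h]
    rw [hpow, ← hi, mul_comm p]
    by_cases hx : i % p ≤ wordLen M C j
    · rw [height_copy hx, height_cell ih2]
      have := ih1 _ hx
      rcases hc with h | h <;> rw [h] <;> constructor <;> linarith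
    · have hp0 : 0 < p := by
        rcases Nat.eq_zero_or_pos p with h | h
        · exfalso
          rw [h, mul_zero] at hip
          have h2 : i % p ≤ i := Nat.mod_le _ _
          omega
        · exact h
      have hlt := Nat.mod_lt i hp0
      obtain ⟨x, hxe⟩ : ∃ x, i % p = wordLen M C j + x := ⟨i % p - wordLen M C j, by omega⟩
      have hxg : x ≤ M * (M + 1) ^ j := by omega
      rw [hxe, height_block hxg, height_cell ih2, ih2]
      have hxg' : (x : ℤ) ≤ (M * (M + 1) ^ j : ℕ) := by exact_mod_cast hxg
      have hx0 : (0 : ℤ) ≤ x := by positivity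
      rcases Nat.mod_two_eq_zero_or_one (i / p) with h | h
      · rw [h, if_pos rfl]; push_cast at *; constructor <;> linarith
      · rw [h, if_neg (by norm_num)]; push_cast at *; constructor <;> linarith

end HardWord

/-! ### Sweeps: the order in which the copies reach their critical times -/

theorem iff_of_no_alternation {E : ℕ → Prop} {x y : ℕ} (hxy : x ≤ y)
    (h : ∀ i, x ≤ i → i < y → (E i ↔ E (i + 1))) : E x ↔ E y := by
  induction y, hxy using Nat.le_induction with
  | base => rfl
  | succ n hn ih =>
    rw [ih fun i h1 h2 => h i h1 (by omega)]
    exact h n hn (by omega)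

/-- L c and R c say that the part left, or right, of copy c is erased at time t c. By the status of
its right side, cell 0 comes before all other cells or after all of them, and likewise cell C - 1.
They are opposite extremes, so all inner times lie strictly between, which decides L and R there.
Nothing constrains L 0 and R (C - 1), hence the restriction to inner cells. -/
theorem sweep_dichotomy {C : ℕ} (hC : 3 ≤ C) (t : ℕ → ℕ) (L R : ℕ → Prop)
    (hL1 : ∀ c < C, ∀ c' < c, L c → t c' < t c) (hL0 : ∀ c < C, ∀ c' < c, ¬ L c → t c < t c')
    (hR1 : ∀ c' < C, ∀ c < c', R c → t c' < t c) (hR0 : ∀ c' < C, ∀ c < c', ¬ R c → t c < t c') :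
    ((∀ c, 0 < c → c + 1 < C → L c ∧ ¬ R c) ∧
      ∀ c c', 0 < c → c < c' → c' + 1 < C → t c < t c') ∨
    ((∀ c, 0 < c → c + 1 < C → ¬ L c ∧ R c) ∧
      ∀ c c', 0 < c → c < c' → c' + 1 < C → t c' < t c) := by
  have h0R : R 0 ↔ t (C - 1) < t 0 := by
    have h1 := hR1 (C - 1) (by omega) 0 (by omega)
    have h0 := hR0 (C - 1) (by omega) 0 (by omega)
    by_cases h : R 0 <;> simp only [h, not_true_eq_false, not_false_eq_true, forall_const] at * <;>
      simp <;> omega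
  have key : ∀ c, 0 < c → c + 1 < C → (L c ∧ ¬ R c ∧ t 0 < t (C - 1)) ∨
      (¬ L c ∧ R c ∧ t (C - 1) < t 0) := by
    intro c hc hc'
    have a1 := hL1 c (by omega) 0 hc
    have a0 := hL0 c (by omega) 0 hc
    have b1 := hR1 (C - 1) (by omega) c (by omega)
    have b0 := hR0 (C - 1) (by omega) c (by omega)
    have c1 := hR1 c (by omega) 0 hc
    have c0 := hR0 c (by omega) 0 hc
    have d1 := hL1 (C - 1) (by omega) c (by omega)
    have d0 := hL0 (C - 1) (by omega) c (by omega)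
    have e1 := hL1 (C - 1) (by omega) 0 (by omega)
    have e0 := hL0 (C - 1) (by omega) 0 (by omega)
    by_cases hl : L c <;> by_cases hr : R c <;> by_cases hl' : L (C - 1) <;> by_cases hr' : R 0 <;>
      simp only [hl, hr, hl', hr', not_true_eq_false, not_false_eq_true, forall_const, true_and,
        false_and, or_false, false_or, true_iff, false_iff, IsEmpty.forall_iff] at * <;> omega
  by_cases hdir : t 0 < t (C - 1)
  · left
    have h1 : ∀ c, 0 < c → c + 1 < C → L c ∧ ¬ R c := by
      intro c hc hc'
      rcases key c hc hc' with h | h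
      · exact ⟨h.1, h.2.1⟩
      · omega
    exact ⟨h1, fun c c' h h' h'' => hR0 c' (by omega) c h' (h1 c h (by omega)).2⟩
  · right
    have h1 : ∀ c, 0 < c → c + 1 < C → ¬ L c ∧ R c := by
      intro c hc hc'
      rcases key c hc hc' with h | h
      · omega
      · exact ⟨h.1, h.2.1⟩
    exact ⟨h1, fun c c' h h' h'' => hR1 c' (by omega) c h' (h1 c h (by omega)).2⟩

/-- The intervals between consecutive values of a monotone t are disjoint, so each needs its own
element of X. -/
theorem le_card_of_separates (X : Finset ℕ) (τ t : ℕ → ℕ) (a n : ℕ)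
    (hsep : ∀ c, a ≤ c → c < a + n → ∃ x ∈ X, min (t c) (t (c + 1)) ≤ τ x ∧
      τ x < max (t c) (t (c + 1)))
    (ht : (∀ c c', a ≤ c → c < c' → c' ≤ a + n → t c < t c') ∨
      (∀ c c', a ≤ c → c < c' → c' ≤ a + n → t c' < t c)) : n ≤ X.card := by
  have hsep' : ∀ c, ∃ x, a ≤ c → c < a + n → x ∈ X ∧ min (t c) (t (c + 1)) ≤ τ x ∧
      τ x < max (t c) (t (c + 1)) := by
    intro c
    by_cases h : a ≤ c ∧ c < a + n
    · obtain ⟨x, hx⟩ := hsep c h.1 h.2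
      exact ⟨x, fun _ _ => hx⟩
    · exact ⟨0, fun h1 h2 => absurd ⟨h1, h2⟩ h⟩
  choose f hf using hsep'
  have hlt : ∀ c c', a ≤ c → c < c' → c' < a + n → f c ≠ f c' := by
    intro c c' h1 h2 h3 heq
    have e1 := (hf c h1 (by omega)).2
    have e2 := (hf c' (by omega) h3).2
    rw [heq] at e1
    rcases ht with ht | ht
    · have i1 := ht c (c + 1) h1 (by omega) (by omega)
      have i2 := ht c' (c' + 1) (by omega) (by omega) (by omega)
      have i3 : t (c + 1) ≤ t c' := by
        rcases Nat.eq_or_lt_of_le (show c + 1 ≤ c' by omega) with h | h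
        · rw [h]
        · exact (ht _ _ (by omega) h (by omega)).le
      omega
    · have i1 := ht c (c + 1) h1 (by omega) (by omega)
      have i2 := ht c' (c' + 1) (by omega) (by omega) (by omega)
      have i3 : t c' ≤ t (c + 1) := by
        rcases Nat.eq_or_lt_of_le (show c + 1 ≤ c' by omega) with h | h
        · rw [h]
        · exact (ht _ _ (by omega) h (by omega)).le
      omega
  have := Finset.card_le_card_of_injOn (s := Finset.Ico a (a + n)) (t := X) f ?_ ?_
  · simpa using this
  · intro c hc
    simp only [Finset.coe_Ico, Set.mem_Ico] at hc
    exact (hf c hc.1 hc.2).1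
  · intro c hc c' hc' heq
    simp only [Finset.coe_Ico, Set.mem_Ico] at hc hc'
    by_contra hne
    rcases Nat.lt_or_gt_of_ne hne with h | h
    · exact hlt c c' hc.1 h hc'.2 heq
    · exact hlt c' c hc'.1 h hc.2 heq.symm

/-- If a factor has as many alternations as a word containing it, then there are no alternations
outside the factor. -/
theorem iff_succ_of_alternations_le {τ : ℕ → ℕ} {r a l b l' : ℕ} (h1 : a ≤ b)
    (h2 : b + l ≤ a + l') (hle : alternations τ r a l' ≤ alternations τ r b l) (i : ℕ) (hi : a ≤ i)
    (hi' : i + 1 < a + l') (hout : i < b ∨ b + l ≤ i + 1) : τ i < r ↔ τ (i + 1) < r := by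
  by_contra hcon
  revert hle
  rw [imp_false, not_le]
  unfold alternations
  rw [← Finset.card_image_of_injective (((Finset.range (l - 1)).filter fun i =>
    ¬(τ (b + i) < r ↔ τ (b + i + 1) < r))) (add_right_injective (b - a))]
  apply Finset.card_lt_card
  rw [Finset.ssubset_iff_of_subset]
  · refine ⟨i - a, ?_, ?_⟩
    · rw [Finset.mem_filter, Finset.mem_range, Nat.add_sub_cancel' hi]
      exact ⟨by omega, hcon⟩
    · simp only [Finset.mem_image, Finset.mem_filter, Finset.mem_range, not_exists]
      intro x hx
      omega
  · intro x hx
    simp only [Finset.mem_image, Finset.mem_filter, Finset.mem_range] at hx ⊢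
    obtain ⟨y, ⟨hy, hy'⟩, rfl⟩ := hx
    have e : a + (b - a + y) = b + y := by omega
    rw [e]
    exact ⟨by omega, hy'⟩

theorem exists_of_alternations_pos {τ : ℕ → ℕ} {r a l : ℕ} (h : 0 < alternations τ r a l) :
    (∃ x, a ≤ x ∧ x < a + l ∧ τ x < r) ∧ ∃ y, a ≤ y ∧ y < a + l ∧ r ≤ τ y := by
  obtain ⟨i, hi⟩ := Finset.card_pos.1 h
  simp only [Finset.mem_filter, Finset.mem_range] at hi
  by_cases h1 : τ (a + i) < r
  · exact ⟨⟨a + i, by omega, by omega, h1⟩, ⟨a + i + 1, by omega, by omega, by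
      by_contra; exact hi.2 ⟨fun _ => by omega, fun _ => h1⟩⟩⟩
  · exact ⟨⟨a + i + 1, by omega, by omega, by
      by_contra h2; exact hi.2 ⟨fun h => absurd h h1, fun h => absurd h h2⟩⟩,
      ⟨a + i, by omega, by omega, by omega⟩⟩

theorem erasedNet_eq_sum_range (σ : ℕ → ℤ) (τ : ℕ → ℕ) (a l r : ℕ) :
    erasedNet σ τ a (a + l) r = ∑ i ∈ Finset.range l, if τ (a + i) < r then σ (a + i) else 0 := by
  unfold erasedNet
  rw [Finset.sum_filter, Finset.sum_Ico_eq_sum_range, Nat.add_sub_cancel_left]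

theorem erasedNet_of_erased {σ : ℕ → ℤ} {τ : ℕ → ℕ} {a l r : ℕ}
    (h : ∀ i, a ≤ i → i < a + l → τ i < r) :
    erasedNet σ τ a (a + l) r = height (fun i => σ (a + i)) l := by
  rw [erasedNet_eq_sum_range]
  refine Finset.sum_congr rfl fun i hi => if_pos (h _ (by omega) ?_)
  have := Finset.mem_range.1 hi
  omega

theorem erasedNet_of_not_erased {σ : ℕ → ℤ} {τ : ℕ → ℕ} {a l r : ℕ}
    (h : ∀ i, a ≤ i → i < a + l → ¬ τ i < r) : erasedNet σ τ a (a + l) r = 0 := by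
  rw [erasedNet_eq_sum_range]
  refine Finset.sum_eq_zero fun i hi => if_neg (h _ (by omega) ?_)
  have := Finset.mem_range.1 hi
  omega

theorem erasedNet_add (σ : ℕ → ℤ) (τ : ℕ → ℕ) (r : ℕ) {a b c : ℕ} (hab : a ≤ b) (hbc : b ≤ c) :
    erasedNet σ τ a c r = erasedNet σ τ a b r + erasedNet σ τ b c r := by
  unfold erasedNet
  simp only [Finset.sum_filter]
  rw [Finset.sum_Ico_consecutive _ hab hbc]

/-! ### Every re-pairing of a hard word has many alternations -/

section

variable {σ : ℕ → ℤ} {m : ℕ} {π τ : ℕ → ℕ} {M C : ℕ}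

/-- A time belongs to a single pair, so three consecutive symbols cannot share it. At the later of
two different adjacent times exactly one of the two symbols has been erased. -/
theorem RePairing.exists_alternations_zero (h : RePairing σ m π τ) {a : ℕ} (ha : a + 4 ≤ m) :
    ∃ r, 1 ≤ alternations τ r a 4 := by
  have hne : ∃ i < 2, τ (a + i) ≠ τ (a + i + 1) := by
    by_contra hcon
    push Not at hcon
    have h0 := hcon 0 (by omega)
    have h1 := hcon 1 (by omega)
    simp only [add_zero] at h0 h1
    have e0 := h.time_inj a (by omega) (a + 1) (by omega) h0
    have e1 := h.time_inj a (by omega) (a + 1 + 1) (by omega) (h0.trans h1)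
    omega
  obtain ⟨i, hi, hne⟩ := hne
  refine ⟨max (τ (a + i)) (τ (a + i + 1)), Finset.card_pos.2 ⟨i, ?_⟩⟩
  simp only [Finset.mem_filter, Finset.mem_range]
  omega

/-- In a sweep the balance of the erased symbols differs between consecutive cells. -/
theorem erasedNet_sweep (hC : C % 2 = 0) {j a c r : ℕ} (hM : 2 * j + 3 ≤ M)
    (hocc : ∀ i < wordLen M C (j + 1), σ (a + i) = hardWord M C (j + 1) i) (hc : c < C)
    (halt : alternations τ r (a + c * (wordLen M C j + M * (M + 1) ^ j)) (wordLen M C j) ≤ j + 1)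
    (ε : ℤ)
    (hside : (ε = 1 ∧ (∀ i, a ≤ i → i < a + c * (wordLen M C j + M * (M + 1) ^ j) → τ i < r) ∧
        (∀ i, a + c * (wordLen M C j + M * (M + 1) ^ j) + wordLen M C j ≤ i →
          i < a + wordLen M C (j + 1) → ¬ τ i < r)) ∨
      (ε = -1 ∧ (∀ i, a ≤ i → i < a + c * (wordLen M C j + M * (M + 1) ^ j) → ¬ τ i < r) ∧
        (∀ i, a + c * (wordLen M C j + M * (M + 1) ^ j) + wordLen M C j ≤ i →
          i < a + wordLen M C (j + 1) → τ i < r))) :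
    2 * |erasedNet σ τ a (a + wordLen M C (j + 1)) r -
      ε * (((c % 2 : ℕ) : ℤ) * (M * (M + 1) ^ j : ℕ))| < (M * (M + 1) ^ j : ℕ) := by
  obtain ⟨hb, hz⟩ := height_hardWord (M := M) hC j
  have hz' := (height_hardWord (M := M) hC (j + 1)).2
  have hcell := height_cell hz c
  have hcell' := height_copy (C := C) (c := c) (le_refl (wordLen M C j))
  rw [hz, hcell, add_zero] at hcell'
  have hcopy := fun x (hx : x < wordLen M C j) => hardWord_succ_copy (C := C) (c := c) hx
  have hle : c * (wordLen M C j + M * (M + 1) ^ j) + (wordLen M C j + M * (M + 1) ^ j) ≤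
      wordLen M C (j + 1) := by
    calc _ = (c + 1) * (wordLen M C j + M * (M + 1) ^ j) := by ring
      _ ≤ C * (wordLen M C j + M * (M + 1) ^ j) := Nat.mul_le_mul_right _ hc
  generalize c * (wordLen M C j + M * (M + 1) ^ j) = s at *
  generalize wordLen M C (j + 1) = l' at *
  obtain ⟨q, rfl⟩ : ∃ q, l' = s + wordLen M C j + q := ⟨l' - (s + wordLen M C j), by omega⟩
  have hmid : |erasedNet σ τ (a + s) (a + s + wordLen M C j) r| ≤
      ((j + 1 : ℕ) : ℤ) * ((M + 1) ^ j : ℕ) := by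
    rw [erasedNet_eq_sum_range]
    have := abs_sum_erased_le (fun i => τ (a + s + i) < r) (hardWord M C j) ((M + 1) ^ j : ℕ)
      (wordLen M C j) (fun i hi => (hb i hi).1) (fun i hi => (hb i hi).2) hz
    refine le_trans (le_of_eq ?_) (this.trans ?_)
    · congr 1
      refine Finset.sum_congr rfl fun i hi => ?_
      have hi' := Finset.mem_range.1 hi
      rw [add_assoc, hocc _ (by omega), hcopy i hi']
    · refine mul_le_mul_of_nonneg_right ?_ (by positivity)
      exact_mod_cast halt
  -- Here M ≥ 2j + 3 is needed: the copy disturbs the balance by less than half a block.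
  have hmid' : 2 * |erasedNet σ τ (a + s) (a + s + wordLen M C j) r| < (M * (M + 1) ^ j : ℕ) := by
    have hG : (0 : ℤ) < ((M + 1) ^ j : ℕ) := by positivity
    have hM' : (2 * j + 3 : ℤ) ≤ M := by exact_mod_cast hM
    push_cast at *
    nlinarith
  have hsum : erasedNet σ τ a (a + (s + wordLen M C j + q)) r = erasedNet σ τ a (a + s) r +
      erasedNet σ τ (a + s) (a + s + wordLen M C j) r +
      erasedNet σ τ (a + s + wordLen M C j) (a + s + wordLen M C j + q) r := by
    rw [← erasedNet_add σ τ r (by omega) (by omega), ← erasedNet_add σ τ r (by omega) (by omega)]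
    congr 1; ring
  have hleft : height (fun i => σ (a + i)) s = ((c % 2 : ℕ) : ℤ) * (M * (M + 1) ^ j : ℕ) := by
    rw [← hcell]
    exact height_congr fun x hx => hocc x (by omega)
  -- The factor ends at its starting height, so what follows the copy sums to minus the height at
  -- which the copy starts.
  have hright : height (fun i => σ (a + s + wordLen M C j + i)) q =
      -(((c % 2 : ℕ) : ℤ) * (M * (M + 1) ^ j : ℕ)) := by
    rw [height_add, hcell'] at hz'
    rw [← eq_neg_iff_add_eq_zero.2 ((add_comm _ _).trans hz')]
    refine height_congr fun x hx => ?_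
    rw [← hocc _ (by omega)]
    congr 1; ring
  rw [hsum]
  rcases hside with ⟨rfl, h1, h2⟩ | ⟨rfl, h1, h2⟩
  · rw [erasedNet_of_erased h1, erasedNet_of_not_erased fun i hi hi' => h2 i hi (by omega), hleft]
    convert hmid' using 3
    ring
  · rw [erasedNet_of_not_erased h1, erasedNet_of_erased fun i hi hi' => h2 i hi (by omega), hright]
    convert hmid' using 3
    ring

/-- H bounds the height inside the factor. The bound passes to the copies, since a cell starts at
most M(M+1)^j = (M+1)^(j+1) - (M+1)^j higher than the factor. The condition C ≥ 2H + 4 makes the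
number C - 3 of sweep steps exceed the number of pairs crossing the boundary. -/
theorem RePairing.exists_alternations (h : RePairing σ m π τ) {H : ℕ} (hC : C % 2 = 0)
    (hCH : 2 * H + 4 ≤ C) (j : ℕ) (hM : 2 * j + 1 ≤ M) (a : ℕ)
    (hocc : ∀ i < wordLen M C j, σ (a + i) = hardWord M C j i) (ham : a + wordLen M C j ≤ m)
    (hH : height σ a + ((M + 1) ^ j : ℕ) ≤ (H : ℤ)) :
    ∃ r, j + 1 ≤ alternations τ r a (wordLen M C j) := by
  induction j generalizing a with
  | zero => exact h.exists_alternations_zero ham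
  | succ j ih =>
    by_contra hcon
    push Not at hcon
    have hlpos : 0 < wordLen M C j := wordLen_pos (by omega) j
    obtain ⟨-, hz⟩ := height_hardWord (M := M) hC j
    set p := wordLen M C j + M * (M + 1) ^ j with hp
    have hl' : wordLen M C (j + 1) = C * p := rfl
    have hstep : ∀ c c', c < c' → c * p + p ≤ c' * p := by
      intro c c' hcc
      calc c * p + p = (c + 1) * p := by ring
        _ ≤ c' * p := Nat.mul_le_mul_right _ hcc
    have ht : ∀ c, ∃ r, c < C → j + 1 ≤ alternations τ r (a + c * p) (wordLen M C j) := by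
      intro c
      by_cases hc : c < C
      · have hcp := hstep c C hc
        obtain ⟨r, hr⟩ := ih (by omega) (a + c * p)
          (fun i hi => by
            rw [add_assoc, hocc _ (by omega), hardWord_succ_copy hi])
          (by omega) (by
            have e : height σ (a + c * p) = height σ a +
                ((c % 2 : ℕ) : ℤ) * (M * (M + 1) ^ j : ℕ) := by
              rw [height_add, ← height_cell hz c]
              congr 1
              exact height_congr fun x hx => hocc x (by omega)
            rw [e]
            have hg : (0 : ℤ) ≤ (M * (M + 1) ^ j : ℕ) := by positivity
            have e2 : ((M + 1) ^ (j + 1) : ℕ) = M * (M + 1) ^ j + (M + 1) ^ j := by ring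
            rw [e2] at hH
            rcases Nat.mod_two_eq_zero_or_one c with hc2 | hc2 <;> rw [hc2] <;> push_cast at * <;>
              linarith)
        exact ⟨r, fun _ => hr⟩
      · exact ⟨0, fun hc' => absurd hc' hc⟩
    choose t ht using ht
    -- The factor has at most j + 1 alternations and copy c already has that many, so none are left
    -- outside it.
    have hcons : ∀ c < C, ∀ i, a ≤ i → i + 1 < a + C * p →
        (i < a + c * p ∨ a + c * p + wordLen M C j ≤ i + 1) →
        (τ i < t c ↔ τ (i + 1) < t c) := by
      intro c hc i h1 h2 h3
      have hcp := hstep c C hc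
      refine iff_succ_of_alternations_le (l := wordLen M C j) (l' := C * p) (b := a + c * p)
        (by omega) (by omega) ?_ i h1 h2 h3
      have h4 := hcon (t c)
      have h5 := ht c hc
      rw [hl'] at h4
      omega
    have hle : ∀ c < C, alternations τ (t c) (a + c * p) (wordLen M C j) ≤ j + 1 := by
      intro c hc
      have hcp := hstep c C hc
      have h4 := hcon (t c)
      refine le_trans ?_ (Nat.lt_succ_iff.1 h4)
      unfold alternations
      refine Finset.card_le_card_of_injOn (fun i => c * p + i) ?_ ?_
      · intro i hi
        simp only [Finset.coe_filter, Finset.mem_range, Set.mem_ofPred_eq] at hi ⊢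
        rw [hl', ← add_assoc]
        exact ⟨by omega, hi.2⟩
      · intro i _ i' _ hii
        simpa using hii
    have hleft : ∀ c < C, ∀ i, a ≤ i → i ≤ a + c * p → (τ i < t c ↔ τ a < t c) := by
      intro c hc i h1 h2
      have hcp := hstep c C hc
      exact (iff_of_no_alternation (E := fun i => τ i < t c) h1 fun i' h3 h4 =>
        hcons c hc i' h3 (by omega) (Or.inl (by omega))).symm
    have hright : ∀ c < C, ∀ i, a + c * p + wordLen M C j ≤ i + 1 → i < a + C * p →
        (τ i < t c ↔ τ (a + C * p - 1) < t c) := by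
      intro c hc i h1 h2
      exact (iff_of_no_alternation (E := fun i => τ i < t c) (by omega) fun i' h3 h4 =>
        hcons c hc i' (by omega) (by omega) (Or.inr (by omega)))
    -- At time t c copy c holds both an erased and a remaining symbol. Comparing one of these with
    -- the uniform status of the copy at another time t c' orders the two times.
    have hxy := fun c (hc : c < C) => exists_of_alternations_pos (τ := τ) (r := t c)
      (a := a + c * p) (l := wordLen M C j) (lt_of_lt_of_le (Nat.succ_pos j) (ht c hc))
    have hsweep := sweep_dichotomy (C := C) (by omega) t (fun c => τ a < t c)
      (fun c => τ (a + C * p - 1) < t c)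
      (by
        intro c hc c' hcc hL
        obtain ⟨-, y, hy1, hy2, hy3⟩ := hxy c' (by omega)
        have := hstep c' c hcc
        have := (hleft c hc y (by omega) (by omega)).2 hL
        omega)
      (by
        intro c hc c' hcc hL
        obtain ⟨⟨x, hx1, hx2, hx3⟩, -⟩ := hxy c' (by omega)
        have := hstep c' c hcc
        have := (not_congr (hleft c hc x (by omega) (by omega))).2 hL
        omega)
      (by
        intro c' hc' c hcc hR
        obtain ⟨-, y, hy1, hy2, hy3⟩ := hxy c' (by omega)
        have := hstep c c' hcc
        have := hstep c' C hc'
        have := (hright c (by omega) y (by omega) (by omega)).2 hR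
        omega)
      (by
        intro c' hc' c hcc hR
        obtain ⟨⟨x, hx1, hx2, hx3⟩, -⟩ := hxy c' (by omega)
        have := hstep c c' hcc
        have := hstep c' C hc'
        have := (not_congr (hright c (by omega) x (by omega) (by omega))).2 hR
        omega)
    have hnet : ∃ ε : ℤ, (ε = 1 ∨ ε = -1) ∧ ∀ c, 0 < c → c + 1 < C →
        2 * |erasedNet σ τ a (a + C * p) (t c) -
          ε * (((c % 2 : ℕ) : ℤ) * (M * (M + 1) ^ j : ℕ))| < (M * (M + 1) ^ j : ℕ) := by
      rcases hsweep with ⟨hs, -⟩ | ⟨hs, -⟩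
      · refine ⟨1, Or.inl rfl, fun c h1 h2 => erasedNet_sweep hC (by omega) hocc (by omega)
          (hle c (by omega)) 1 (Or.inl ⟨rfl, ?_, ?_⟩)⟩
        · intro i hi hi'
          exact (hleft c (by omega) i hi hi'.le).2 (hs c h1 h2).1
        · intro i hi hi'
          rw [← hp] at hi
          rw [hright c (by omega) i (by omega) hi']
          exact (hs c h1 h2).2
      · refine ⟨-1, Or.inr rfl, fun c h1 h2 => erasedNet_sweep hC (by omega) hocc (by omega)
          (hle c (by omega)) (-1) (Or.inr ⟨rfl, ?_, ?_⟩)⟩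
        · intro i hi hi'
          rw [hleft c (by omega) i hi hi'.le]
          exact (hs c h1 h2).1
        · intro i hi hi'
          rw [← hp] at hi
          exact (hright c (by omega) i (by omega) hi').2 (hs c h1 h2).2
    obtain ⟨ε, hε, hnet⟩ := hnet
    rw [hl'] at ham
    -- The inner cells 1, …, C - 2 give C - 3 consecutive steps.
    have hcard := le_card_of_separates
      ((Finset.Ico a (a + C * p)).filter fun i => ¬(a ≤ π i ∧ π i < a + C * p)) τ t 1 (C - 3) ?_ ?_
    · have hb := h.card_boundary (a := a) (b := a + C * p) (by omega) ham
      have e : height σ (a + C * p) = height σ a := by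
        rw [height_add, ← hl', height_congr (ρ := hardWord M C (j + 1)) (fun x hx => hocc x hx),
          (height_hardWord hC (j + 1)).2, add_zero]
      rw [e] at hb
      have hpos : (0 : ℤ) < ((M + 1) ^ (j + 1) : ℕ) := by positivity
      omega
    · intro c h1 h2
      -- Otherwise the erased balance would be the same at both times. But at one of them it is
      -- within less than half a block of 0, and at the other within less than half a block of ± a
      -- full block.
      by_contra hno
      have heq : erasedNet σ τ a (a + C * p) (min (t c) (t (c + 1))) =
          erasedNet σ τ a (a + C * p) (max (t c) (t (c + 1))) :=
        h.erasedNet_eq ham min_le_max fun i hi hi' => hno ⟨i, hi, hi'⟩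
      have heq' : erasedNet σ τ a (a + C * p) (t c) = erasedNet σ τ a (a + C * p) (t (c + 1)) := by
        rcases le_total (t c) (t (c + 1)) with h' | h'
        · rwa [min_eq_left h', max_eq_right h'] at heq
        · rw [min_eq_right h', max_eq_left h'] at heq
          exact heq.symm
      have n1 := hnet c (by omega) (by omega)
      have n2 := hnet (c + 1) (by omega) (by omega)
      rw [← heq'] at n2
      generalize erasedNet σ τ a (a + C * p) (t c) = z at n1 n2
      generalize ((M * (M + 1) ^ j : ℕ) : ℤ) = g at n1 n2
      have a1 := abs_le.1 (le_refl |z - ε * (((c % 2 : ℕ) : ℤ) * g)|)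
      have a2 := abs_le.1 (le_refl |z - ε * ((((c + 1) % 2 : ℕ) : ℤ) * g)|)
      rcases Nat.mod_two_eq_zero_or_one c with hc2 | hc2
      · have hc3 : (c + 1) % 2 = 1 := by omega
        rw [hc2] at n1 a1
        rw [hc3] at n2 a2
        rcases hε with rfl | rfl <;> push_cast at * <;> linarith
      · have hc3 : (c + 1) % 2 = 0 := by omega
        rw [hc2] at n1 a1
        rw [hc3] at n2 a2
        rcases hε with rfl | rfl <;> push_cast at * <;> linarith
    · rcases hsweep with ⟨-, hs⟩ | ⟨-, hs⟩
      · exact Or.inl fun c c' h1 h2 h3 => hs c c' h1 h2 (by omega)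
      · exact Or.inr fun c c' h1 h2 h3 => hs c c' h1 h2 (by omega)

end

/-! ### From balanced windows to a re-pairing, by Hall's theorem -/

section

variable {σ : ℕ → ℤ} {m N L e R : ℕ} {cnt : ℕ → ℕ → ℕ}

/-- The windows in which both `k` and `l` occur. -/
def commonWindows (cnt : ℕ → ℕ → ℕ) (R k l : ℕ) : Finset ℕ :=
  (Finset.range R).filter fun r => 0 < cnt r k ∧ 0 < cnt r l

/-- The windows containing a pair of symbols that rarely occur together. -/
def rareWindows (cnt : ℕ → ℕ → ℕ) (R m : ℕ) : Finset ℕ :=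
  (((Finset.range m) ×ˢ (Finset.range m)).filter
    fun x => (commonWindows cnt R x.1 x.2).card ≤ m).biUnion fun x => commonWindows cnt R x.1 x.2

theorem card_rareWindows_le : (rareWindows cnt R m).card ≤ m ^ 3 := by
  refine (Finset.card_biUnion_le_card_mul _ _ m fun x hx => (Finset.mem_filter.1 hx).2).trans ?_
  refine (Nat.mul_le_mul_right m (Finset.card_filter_le _ _)).trans ?_
  rw [Finset.card_product, Finset.card_range]
  exact le_of_eq (by ring)

/-- Double counting over windows. Outside the rare windows, the occurrences of A exceed those of its
neighbourhood B by at most e; there are at most m^3 rare windows, and each costs at most L. Since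
every symbol occurs N times in all, A cannot outnumber B. -/
theorem hall_condition_windows (hσ : ∀ i < m, σ i = 1 ∨ σ i = -1)
    (hN : ∀ k < m, ∑ r ∈ Finset.range R, cnt r k = N)
    (hL : ∀ r < R, ∑ k ∈ Finset.range m, cnt r k ≤ L)
    (he : ∀ r < R, ∀ k₀ < m, ∑ k ∈ Finset.Ico k₀ m, σ k * cnt r k ≤ e)
    (hbig : e * R + m ^ 3 * L < N) (A B : Finset ℕ) (hA : ∀ k ∈ A, k < m ∧ σ k = 1)
    (hB' : ∀ l ∈ B, l < m)
    (hB : ∀ k ∈ A, ∀ l < m, σ l = -1 → k < l → m < (commonWindows cnt R k l).card → l ∈ B) :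
    A.card ≤ B.card := by
  have hwin : ∀ r ∈ Finset.range R, ∑ k ∈ A, cnt r k ≤
      ∑ l ∈ B, cnt r l + (e + if r ∈ rareWindows cnt R m then L else 0) := by
    intro r hr
    have hr' := Finset.mem_range.1 hr
    by_cases hrare : r ∈ rareWindows cnt R m
    · rw [if_pos hrare]
      have : ∑ k ∈ A, cnt r k ≤ ∑ k ∈ Finset.range m, cnt r k :=
        Finset.sum_le_sum_of_subset fun k hk => Finset.mem_range.2 (hA k hk).1
      have := hL r hr'
      omega
    · rw [if_neg hrare, add_zero]
      rcases (A.filter fun k => 0 < cnt r k).eq_empty_or_nonempty with hemp | hne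
      · rw [Finset.sum_eq_zero]
        · exact Nat.zero_le _
        · intro k hk
          by_contra h0
          have : k ∈ A.filter fun k => 0 < cnt r k := Finset.mem_filter.2 ⟨hk, Nat.pos_of_ne_zero h0⟩
          rw [hemp] at this
          exact absurd this (Finset.notMem_empty _)
      -- The first symbol of A present in the window suffices: every closing symbol after it in this
      -- window is a neighbour of it.
      · set k₀ := (A.filter fun k => 0 < cnt r k).min' hne with hk₀
        obtain ⟨hk₀A, hk₀r⟩ := Finset.mem_filter.1 (Finset.min'_mem _ hne)
        rw [← hk₀] at hk₀A hk₀r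
        have hmin : ∀ k ∈ A, 0 < cnt r k → k₀ ≤ k := fun k hk hk' =>
          Finset.min'_le _ _ (Finset.mem_filter.2 ⟨hk, hk'⟩)
        obtain ⟨hk₀m, hk₀σ⟩ := hA k₀ hk₀A
        have h1 : ∑ k ∈ A, cnt r k ≤ ∑ k ∈ (Finset.Ico k₀ m).filter (fun k => σ k = 1), cnt r k := by
          refine Finset.sum_le_sum_of_ne_zero fun k hk hk0 => ?_
          simp only [Finset.mem_filter, Finset.mem_Ico]
          exact ⟨⟨hmin k hk (Nat.pos_of_ne_zero hk0), (hA k hk).1⟩, (hA k hk).2⟩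
        have h2 : ∑ k ∈ (Finset.Ico k₀ m).filter (fun k => ¬ σ k = 1), cnt r k ≤
            ∑ l ∈ B, cnt r l := by
          refine Finset.sum_le_sum_of_ne_zero fun l hl hl0 => ?_
          simp only [Finset.mem_filter, Finset.mem_Ico] at hl
          have hlσ := (hσ l hl.1.2).resolve_left hl.2
          refine hB k₀ hk₀A l hl.1.2 hlσ (lt_of_le_of_ne hl.1.1 ?_) ?_
          · rintro rfl
            exact hl.2 hk₀σ
          · by_contra hcon
            -- If k₀ and l shared at most m windows, this window would be rare.
            refine hrare (Finset.mem_biUnion.2 ⟨(k₀, l), ?_, ?_⟩)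
            · simp only [Finset.mem_filter, Finset.mem_product, Finset.mem_range]
              exact ⟨⟨hk₀m, hl.1.2⟩, not_lt.1 hcon⟩
            · simp only [commonWindows, Finset.mem_filter, Finset.mem_range]
              exact ⟨hr', hk₀r, Nat.pos_of_ne_zero hl0⟩
        have h3 := he r hr' k₀ hk₀m
        rw [← Finset.sum_filter_add_sum_filter_not _ (fun k => σ k = 1)] at h3
        have e1 : ∑ k ∈ (Finset.Ico k₀ m).filter (fun k => σ k = 1), σ k * cnt r k =
            ((∑ k ∈ (Finset.Ico k₀ m).filter (fun k => σ k = 1), cnt r k : ℕ) : ℤ) := by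
          rw [Nat.cast_sum]
          refine Finset.sum_congr rfl fun k hk => ?_
          rw [(Finset.mem_filter.1 hk).2, one_mul]
        have e2 : ∑ k ∈ (Finset.Ico k₀ m).filter (fun k => ¬ σ k = 1), σ k * cnt r k =
            -((∑ k ∈ (Finset.Ico k₀ m).filter (fun k => ¬ σ k = 1), cnt r k : ℕ) : ℤ) := by
          rw [Nat.cast_sum, ← Finset.sum_neg_distrib]
          refine Finset.sum_congr rfl fun k hk => ?_
          obtain ⟨hk1, hk2⟩ := Finset.mem_filter.1 hk
          rw [(hσ k (Finset.mem_Ico.1 hk1).2).resolve_left hk2, neg_one_mul]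
        rw [e1, e2] at h3
        omega
  -- Summation gives |A| N ≤ |B| N + eR + m^3 L < (|B| + 1) N.
  have htot := Finset.sum_le_sum hwin
  rw [Finset.sum_comm, Finset.sum_add_distrib, Finset.sum_comm (t := B), Finset.sum_add_distrib,
    Finset.sum_congr rfl fun k hk => hN k (hA k hk).1,
    Finset.sum_congr rfl fun k hk => hN k (hB' k hk), ← Finset.sum_filter] at htot
  simp only [Finset.sum_const, smul_eq_mul, Finset.card_range] at htot
  have hrare : ((Finset.range R).filter fun r => r ∈ rareWindows cnt R m).card ≤ m ^ 3 :=
    (Finset.card_le_card fun r hr => (Finset.mem_filter.1 hr).2).trans card_rareWindows_le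
  have hrareL := Nat.mul_le_mul_right L hrare
  by_contra hcon
  have h4 : (B.card + 1) * N ≤ A.card * N := Nat.mul_le_mul_right N (by omega)
  nlinarith

/-- If, in each window, the symbols are balanced up to a small error, then the word has a
re-pairing in which each pair is erased at the time of a window that contains both of its symbols. -/
theorem exists_rePairing (hσ : ∀ i < m, σ i = 1 ∨ σ i = -1) (h0 : height σ m = 0)
    (hN : ∀ k < m, ∑ r ∈ Finset.range R, cnt r k = N)
    (hL : ∀ r < R, ∑ k ∈ Finset.range m, cnt r k ≤ L)
    (he : ∀ r < R, ∀ k₀ < m, ∑ k ∈ Finset.Ico k₀ m, σ k * cnt r k ≤ e)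
    (hbig : e * R + m ^ 3 * L < N) :
    ∃ π τ : ℕ → ℕ, RePairing σ m π τ ∧ ∀ k < m, τ k < R ∧ 0 < cnt (τ k) k := by
  classical
  set O := (Finset.range m).filter fun i => σ i = 1 with hO
  set D := (Finset.range m).filter fun i => σ i = -1 with hD
  have memO : ∀ i, i ∈ O ↔ i < m ∧ σ i = 1 := by simp [hO]
  have memD : ∀ i, i ∈ D ↔ i < m ∧ σ i = -1 := by simp [hD]
  have hcard : O.card = D.card := by
    have h1 : height σ m = O.card - D.card := by
      unfold height
      rw [← Finset.sum_filter_add_sum_filter_not _ (fun k => σ k = 1)]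
      have : (Finset.range m).filter (fun i => ¬ σ i = 1) = D := by
        ext i
        simp only [Finset.mem_filter, Finset.mem_range, memD]
        constructor
        · rintro ⟨h1, h2⟩
          exact ⟨h1, (hσ i h1).resolve_left h2⟩
        · rintro ⟨h1, h2⟩
          exact ⟨h1, by omega⟩
      rw [this, ← hO, Finset.sum_congr rfl fun i hi => ((memO i).1 hi).2,
        Finset.sum_congr rfl fun i hi => ((memD i).1 hi).2]
      simp [sub_eq_add_neg]
    omega
  have hO_le : O.card ≤ m := by
    simpa using Finset.card_filter_le (Finset.range m) fun i => σ i = 1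
  -- First use of Hall: a partner to the right that shares more than m windows.
  obtain ⟨f, hf, hft⟩ := (Finset.all_card_le_biUnion_card_iff_exists_injective
    (fun k : O => D.filter fun l => (k : ℕ) < l ∧ m < (commonWindows cnt R k l).card)).1 (by
      intro s
      have := hall_condition_windows hσ hN hL he hbig (s.map (Function.Embedding.subtype _))
        (s.biUnion fun k : O => D.filter fun l => (k : ℕ) < l ∧ m < (commonWindows cnt R k l).card)
        ?_ ?_ ?_
      · simpa using this
      · intro k hk
        obtain ⟨x, -, rfl⟩ := Finset.mem_map.1 hk
        exact (memO _).1 x.2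
      · intro l hl
        obtain ⟨x, -, hx⟩ := Finset.mem_biUnion.1 hl
        exact ((memD _).1 (Finset.mem_filter.1 hx).1).1
      · intro k hk l hl hl' hkl hW
        obtain ⟨x, hx, rfl⟩ := Finset.mem_map.1 hk
        exact Finset.mem_biUnion.2 ⟨x, hx, Finset.mem_filter.2 ⟨(memD _).2 ⟨hl, hl'⟩, hkl, hW⟩⟩)
  simp only [Finset.mem_filter] at hft
  -- Second use of Hall: each of the at most m pairs has more than m common windows, so distinct
  -- windows can be chosen. They become the erasure times.
  obtain ⟨g, hg, hgt⟩ := (Finset.all_card_le_biUnion_card_iff_exists_injective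
    (fun k : O => commonWindows cnt R k (f k))).1 (by
      intro s
      rcases s.eq_empty_or_nonempty with rfl | ⟨k, hk⟩
      · simp
      · have h1 : s.card ≤ O.card := by simpa using Finset.card_le_univ s
        have h2 := Finset.card_le_card
          (Finset.subset_biUnion_of_mem (fun k : O => commonWindows cnt R k (f k)) hk)
        have h3 := (hft k).2.2
        omega)
  simp only [commonWindows, Finset.mem_filter, Finset.mem_range] at hgt
  let f' : O → D := fun k => ⟨f k, (hft k).1⟩
  have hf' : Function.Bijective f' := by
    rw [Fintype.bijective_iff_injective_and_card]
    refine ⟨fun x y hxy => hf (congrArg Subtype.val hxy), ?_⟩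
    simpa using hcard
  set E := Equiv.ofBijective f' hf' with hE
  have hEf : ∀ k, ((E k : D) : ℕ) = f k := fun k => rfl
  have hnot : ∀ i, i ∈ D → i ∉ O := by
    intro i hi hi'
    have h1 := ((memD i).1 hi).2
    have h2 := ((memO i).1 hi').2
    omega
  let π : ℕ → ℕ := fun i => if h : i ∈ O then f ⟨i, h⟩ else
    if h : i ∈ D then ((E.symm ⟨i, h⟩ : O) : ℕ) else i
  let τ : ℕ → ℕ := fun i => if h : i ∈ O then g ⟨i, h⟩ else
    if h : i ∈ D then g (E.symm ⟨i, h⟩) else 0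
  have πO : ∀ k : O, π k = f k := fun k => by simp [π]
  have πE : ∀ k : O, π (f k) = k := fun k => by
    have h1 : f k ∈ D := (hft k).1
    simp only [π, dif_neg (hnot _ h1), dif_pos h1]
    have : (⟨f k, h1⟩ : D) = E k := rfl
    rw [this, Equiv.symm_apply_apply]
  have τO : ∀ k : O, τ k = g k := fun k => by simp [τ]
  have τE : ∀ k : O, τ (f k) = g k := fun k => by
    have h1 : f k ∈ D := (hft k).1
    simp only [τ, dif_neg (hnot _ h1), dif_pos h1]
    have : (⟨f k, h1⟩ : D) = E k := rfl
    rw [this, Equiv.symm_apply_apply]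
  have hcases : ∀ i < m, ∃ k : O, i = k ∨ i = f k := by
    intro i hi
    rcases hσ i hi with h | h
    · exact ⟨⟨i, (memO i).2 ⟨hi, h⟩⟩, Or.inl rfl⟩
    · have h1 : i ∈ D := (memD i).2 ⟨hi, h⟩
      refine ⟨E.symm ⟨i, h1⟩, Or.inr ?_⟩
      rw [← hEf, Equiv.apply_symm_apply]
  have kO : ∀ k : O, (k : ℕ) < m ∧ σ k = 1 := fun k => (memO _).1 k.2
  have kD : ∀ k : O, f k < m ∧ σ (f k) = -1 := fun k => (memD _).1 (hft k).1
  refine ⟨π, τ, ⟨hσ, ?_, ?_, ?_, ?_, ?_, ?_⟩, ?_⟩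
  · intro i hi
    obtain ⟨k, rfl | rfl⟩ := hcases i hi
    · rw [πO]; exact (kD k).1
    · rw [πE]; exact (kO k).1
  · intro i hi
    obtain ⟨k, rfl | rfl⟩ := hcases i hi
    · rw [πO, πE]
    · rw [πE, πO]
  · intro i hi
    obtain ⟨k, rfl | rfl⟩ := hcases i hi
    · rw [πO, (kD k).2, (kO k).2]
    · rw [πE, (kD k).2, (kO k).2, neg_neg]
  · intro i hi hi'
    obtain ⟨k, rfl | rfl⟩ := hcases i hi
    · rw [πO]; exact (hft k).2.1
    · rw [(kD k).2] at hi'; omega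
  · intro i hi
    obtain ⟨k, rfl | rfl⟩ := hcases i hi
    · rw [πO, τE, τO]
    · rw [πE, τE, τO]
  · intro i hi j hj hij
    obtain ⟨k, rfl | rfl⟩ := hcases i hi <;> obtain ⟨k', rfl | rfl⟩ := hcases j hj <;>
      simp only [τO, τE, πO, πE] at hij ⊢ <;> have := hg hij <;> subst this <;> simp
  · intro i hi
    obtain ⟨k, rfl | rfl⟩ := hcases i hi
    · rw [τO]; exact ⟨(hgt k).1, (hgt k).2.1⟩
    · rw [τE]; exact ⟨(hgt k).1, (hgt k).2.2⟩

end

/-! ### Chains, their vectors in U_n, and mixing two chains -/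

section

variable {n m Q : ℕ}

/-- The nodes of a chain from `0` to `n - 1`. The node `k + 1`, for `k < m`, is in the block `k` of
length `2 * Q`. It is even if and only if `σ k = 1`, and selected by `x k` among the `Q` candidates
of this parity. -/
def chainNode (n : ℕ) {m Q : ℕ} (σ : ℕ → ℤ) (x : Fin m → Fin Q) : ℕ → ℕ
  | 0 => 0
  | k + 1 => if h : k < m then 2 + 2 * Q * k + 2 * (x ⟨k, h⟩ : ℕ) + if σ k = 1 then 0 else 1
      else n - 1

variable {σ : ℕ → ℤ}

theorem chainNode_succ_bounds (x : Fin m → Fin Q) {k : ℕ} (hk : k < m) :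
    2 + 2 * Q * k ≤ chainNode n σ x (k + 1) ∧ chainNode n σ x (k + 1) + 1 ≤ 2 + 2 * Q * (k + 1) := by
  have h1 := (x ⟨k, hk⟩).2
  have h2 : 2 * Q * (k + 1) = 2 * Q * k + 2 * Q := by ring
  simp only [chainNode, dif_pos hk]
  split_ifs <;> omega

/-- The blocks are disjoint and ordered, so a node determines its level even when it is taken from
different chains. -/
theorem chainNode_lt_chainNode (hn : 2 * Q * m + 3 ≤ n) (x y : Fin m → Fin Q) {k k' : ℕ}
    (hk : k < k') (hk' : k' ≤ m + 1) : chainNode n σ x k < chainNode n σ y k' := by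
  obtain ⟨l', rfl⟩ : ∃ l', k' = l' + 1 := ⟨k' - 1, by omega⟩
  rcases Nat.lt_or_ge l' m with h | h
  · have b' := chainNode_succ_bounds (n := n) (σ := σ) y h
    rcases k with _ | l
    · simp only [chainNode] at b' ⊢; omega
    · have b := chainNode_succ_bounds (n := n) (σ := σ) x (show l < m by omega)
      have : 2 * Q * (l + 1) ≤ 2 * Q * l' := Nat.mul_le_mul_left _ (by omega)
      omega
  · have e : chainNode n σ y (l' + 1) = n - 1 := by simp [chainNode, Nat.not_lt.2 h]
    rw [e]
    rcases k with _ | l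
    · simp only [chainNode]; omega
    · have b := chainNode_succ_bounds (n := n) (σ := σ) x (show l < m by omega)
      have : 2 * Q * (l + 1) ≤ 2 * Q * m := Nat.mul_le_mul_left _ (by omega)
      omega

theorem chainNode_last (x : Fin m → Fin Q) : chainNode n σ x (m + 1) = n - 1 := by
  simp [chainNode]

theorem chainNode_lt (hn : 2 * Q * m + 3 ≤ n) (x : Fin m → Fin Q) (k : ℕ) :
    chainNode n σ x k < n := by
  rcases k with _ | k
  · simp only [chainNode]; omega
  · rcases Nat.lt_or_ge k m with h | h
    · have b := chainNode_succ_bounds (n := n) (σ := σ) x h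
      have : 2 * Q * (k + 1) ≤ 2 * Q * m := Nat.mul_le_mul_left _ (by omega)
      omega
    · simp only [chainNode, dif_neg (Nat.not_lt.2 h)]; omega

/-- The node `k` of the chain, as an element of `Fin n`. -/
def nodeFin (hn : 2 * Q * m + 3 ≤ n) (σ : ℕ → ℤ) (x : Fin m → Fin Q) (k : ℕ) : Fin n :=
  ⟨chainNode n σ x k, chainNode_lt hn x k⟩

variable {hn : 2 * Q * m + 3 ≤ n}

theorem nodeFin_lt (x y : Fin m → Fin Q) {k k' : ℕ} (hk : k < k') (hk' : k' ≤ m + 1) :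
    nodeFin hn σ x k < nodeFin hn σ y k' :=
  chainNode_lt_chainNode hn x y hk hk'

theorem nodeFin_level (x y : Fin m → Fin Q) {k k' : ℕ} (hk : k ≤ m + 1) (hk' : k' ≤ m + 1)
    (h : nodeFin hn σ x k = nodeFin hn σ y k') : k = k' := by
  rcases Nat.lt_trichotomy k k' with h1 | h1 | h1
  · exact absurd h (nodeFin_lt x y h1 hk').ne
  · exact h1
  · exact absurd h (nodeFin_lt y x h1 hk).ne'

theorem nodeFin_le_iff (x : Fin m → Fin Q) {k k' : ℕ} (hk : k ≤ m + 1) (hk' : k' ≤ m + 1) :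
    nodeFin hn σ x k ≤ nodeFin hn σ x k' ↔ k ≤ k' := by
  constructor
  · intro h
    by_contra hcon
    exact absurd h (not_le.2 (nodeFin_lt x x (not_le.1 hcon) hk))
  · intro h
    rcases Nat.eq_or_lt_of_le h with rfl | h
    · exact le_rfl
    · exact (nodeFin_lt x x h hk').le

theorem eq_of_nodeFin_eq (x y : Fin m → Fin Q) (k : Fin m)
    (h : nodeFin hn σ x (k + 1) = nodeFin hn σ y (k + 1)) : x k = y k := by
  have := congrArg Fin.val h
  simp only [nodeFin, chainNode, k.2, dif_pos, Fin.eta] at this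
  ext
  omega

theorem neg_one_pow_nodeFin (x : Fin m → Fin Q) {k : ℕ} (hk : k < m)
    (hσ : σ k = 1 ∨ σ k = -1) : (-1 : ℤ) ^ ((nodeFin hn σ x (k + 1) : Fin n) : ℕ) = σ k := by
  simp only [nodeFin, chainNode, dif_pos hk]
  rcases hσ with h | h
  · rw [if_pos h, h]
    exact Even.neg_one_pow ⟨1 + Q * k + x ⟨k, hk⟩, by ring⟩
  · rw [if_neg (by omega), h]
    exact Odd.neg_one_pow ⟨1 + Q * k + x ⟨k, hk⟩, by ring⟩

/-- Alternating sums of vectors supported by the inner nodes of a chain. -/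
theorem sum_neg_one_pow_nodes (hσ : ∀ k < m, σ k = 1 ∨ σ k = -1) (x : Fin m → Fin Q)
    (f : Fin n → ℤ) (hf : ∀ i, f i ≠ 0 → ∃ k < m, nodeFin hn σ x (k + 1) = i) (T : Finset (Fin n)) :
    ∑ i ∈ T, (-1 : ℤ) ^ (i : ℕ) * f i =
      ∑ k ∈ Finset.range m, if nodeFin hn σ x (k + 1) ∈ T
        then σ k * f (nodeFin hn σ x (k + 1)) else 0 := by
  classical
  rw [← Finset.sum_filter]
  have h1 : ∀ k ∈ (Finset.range m).filter (fun k => nodeFin hn σ x (k + 1) ∈ T),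
      σ k * f (nodeFin hn σ x (k + 1)) =
      (-1 : ℤ) ^ ((nodeFin hn σ x (k + 1) : Fin n) : ℕ) * f (nodeFin hn σ x (k + 1)) := by
    intro k hk
    have hk' := Finset.mem_range.1 (Finset.mem_filter.1 hk).1
    rw [neg_one_pow_nodeFin x hk' (hσ k hk')]
  rw [Finset.sum_congr rfl h1, ← Finset.sum_image
    (f := fun i : Fin n => (-1 : ℤ) ^ (i : ℕ) * f i) (g := fun k => nodeFin hn σ x (k + 1))]
  · symm
    refine Finset.sum_subset ?_ ?_
    · intro i hi
      obtain ⟨k, hk, rfl⟩ := Finset.mem_image.1 hi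
      exact (Finset.mem_filter.1 hk).2
    · intro i hi hi'
      by_contra hne
      obtain ⟨k, hk, rfl⟩ := hf i (right_ne_zero_of_mul hne)
      exact hi' (Finset.mem_image.2 ⟨k, Finset.mem_filter.2 ⟨Finset.mem_range.2 hk, hi⟩, rfl⟩)
  · intro k hk k' hk' h
    simp only [Finset.coe_filter, Finset.mem_range, Set.mem_ofPred_eq] at hk hk'
    have := nodeFin_level x x (by omega) (by omega) h
    omega

open Classical in
/-- The vector of the chain `nodeFin hn σ x` in which each inner node has multiplicity `N`. -/
noncomputable def chainVec (hn : 2 * Q * m + 3 ≤ n) (σ : ℕ → ℤ) (x : Fin m → Fin Q) (N : ℕ) :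
    UnivLetter n → ℕ :=
  Sum.elim
    (fun e => if ∃ k ≤ m, nodeFin hn σ x k = e.1.1 ∧ nodeFin hn σ x (k + 1) = e.1.2 then 1 else 0)
    (fun i => if ∃ k < m, nodeFin hn σ x (k + 1) = i then N else 0)

theorem chainVec_letterC {x : Fin m → Fin Q} {N : ℕ} {i j : Fin n} {h : i < j} :
    (0 < chainVec hn σ x N (letterC i j h) ↔
      ∃ k ≤ m, nodeFin hn σ x k = i ∧ nodeFin hn σ x (k + 1) = j) ∧
    chainVec hn σ x N (letterC i j h) ≤ 1 := by
  simp only [chainVec, letterC, Sum.elim_inl]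
  split_ifs with h <;> simp [h]

theorem chainVec_letterA_node {x : Fin m → Fin Q} {N k : ℕ} (hk : k < m) :
    chainVec hn σ x N (letterA (nodeFin hn σ x (k + 1))) = N := by
  simp only [chainVec, letterA, Sum.elim_inr]
  rw [if_pos ⟨k, hk, rfl⟩]

theorem exists_of_chainVec_letterA_ne_zero {x : Fin m → Fin Q} {N : ℕ} {i : Fin n}
    (h : chainVec hn σ x N (letterA i) ≠ 0) : ∃ k < m, nodeFin hn σ x (k + 1) = i := by
  simp only [chainVec, letterA, Sum.elim_inr] at h
  by_contra hcon
  exact h (if_neg hcon)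

theorem sum_range_ite_eq_height (σ : ℕ → ℤ) (p : ℕ → Prop) [DecidablePred p] (m : ℕ)
    (hp : ∀ k, p (k + 1) → p k) :
    ∃ k ≤ m, ∑ i ∈ Finset.range m, (if p i then σ i else 0) = height σ k ∧ ∀ i < k, p i := by
  induction m with
  | zero => exact ⟨0, le_rfl, by simp [height], by simp⟩
  | succ m ih =>
    obtain ⟨k, hk, hk', hk''⟩ := ih
    rw [Finset.sum_range_succ, hk']
    by_cases h : p m
    · have hall : ∀ d ≤ m, p (m - d) := by
        intro d
        induction d with
        | zero => simpa using h
        | succ d ihd =>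
          intro hd
          have := ihd (by omega)
          apply hp
          rwa [show m - (d + 1) + 1 = m - d by omega]
      have hall' : ∀ i ≤ m, p i := fun i hi => by
        have := hall (m - i) (by omega)
        rwa [show m - (m - i) = i by omega] at this
      refine ⟨m + 1, le_rfl, ?_, fun i hi => hall' i (by omega)⟩
      rw [if_pos h, ← hk']
      unfold height
      rw [Finset.sum_range_succ]
      congr 1
      exact Finset.sum_congr rfl fun i hi => if_pos (hall' i (by have := Finset.mem_range.1 hi; omega))
    · exact ⟨k, by omega, by rw [if_neg h, add_zero], hk''⟩

/-- The parity of node k + 1 encodes σ k, so the alternating sums are N times heights of σ. -/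
theorem chainVec_mem (hσ : ∀ k < m, σ k = 1 ∨ σ k = -1) (h0 : ∀ k ≤ m, 0 ≤ height σ k)
    (hm : height σ m = 0) (x : Fin m → Fin Q) (N : ℕ) :
    chainVec hn σ x N ∈ universalOneCounterSet n := by
  refine ⟨⟨?_, ?_⟩, ⟨?_, ?_⟩, ?_⟩
  · intro i j h
    have := (chainVec_letterC (hn := hn) (σ := σ) (x := x) (N := N) (h := h)).2
    omega
  · refine ⟨m + 1, fun s => nodeFin hn σ x s, ?_, ?_, ?_, ?_⟩
    · intro s s' h
      exact nodeFin_lt x x h (by omega)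
    · simp [nodeFin, chainNode]
    · simp only [nodeFin, Fin.val_last, chainNode_last]; omega
    · intro i j h
      have := (chainVec_letterC (hn := hn) (σ := σ) (x := x) (N := N) (h := h))
      rw [show chainVec hn σ x N (letterC i j h) = 1 ↔ 0 < chainVec hn σ x N (letterC i j h) by
        omega, this.1]
      constructor
      · rintro ⟨k, hk, hk'⟩
        exact ⟨⟨k, by omega⟩, by simpa using hk'⟩
      · rintro ⟨s, hs⟩
        exact ⟨s, by omega, by simpa using hs⟩
  · rw [sum_neg_one_pow_nodes hσ x (fun i => (chainVec hn σ x N (letterA i) : ℤ))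
      (fun i hi => exists_of_chainVec_letterA_ne_zero (by exact_mod_cast hi))]
    have : ∑ k ∈ Finset.range m, (if nodeFin hn σ x (k + 1) ∈ Finset.univ then
        σ k * (chainVec hn σ x N (letterA (nodeFin hn σ x (k + 1))) : ℤ) else 0) =
        height σ m * N := by
      unfold height
      rw [Finset.sum_mul]
      refine Finset.sum_congr rfl fun k hk => ?_
      rw [if_pos (Finset.mem_univ _), chainVec_letterA_node (Finset.mem_range.1 hk)]
    rw [this, hm, zero_mul]
  · intro K _
    rw [sum_neg_one_pow_nodes hσ x (fun i => (chainVec hn σ x N (letterA i) : ℤ))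
      (fun i hi => exists_of_chainVec_letterA_ne_zero (by exact_mod_cast hi))]
    obtain ⟨k, hk, hk', -⟩ := sum_range_ite_eq_height σ
      (fun k => k < m ∧ nodeFin hn σ x (k + 1) ≤ K) m
      (fun k hk => ⟨by omega, (nodeFin_lt x x (by omega) (by omega)).le.trans hk.2⟩)
    have : ∑ k ∈ Finset.range m, (if nodeFin hn σ x (k + 1) ∈ Finset.Iic K then
        σ k * (chainVec hn σ x N (letterA (nodeFin hn σ x (k + 1))) : ℤ) else 0) =
        height σ k * N := by
      rw [← hk', Finset.sum_mul]
      refine Finset.sum_congr rfl fun k hk => ?_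
      rw [chainVec_letterA_node (Finset.mem_range.1 hk), ite_mul, zero_mul]
      simp only [Finset.mem_Iic, Finset.mem_range.1 hk, true_and]
    rw [this]
    exact mul_nonneg (h0 k hk) (by positivity)
  · intro j hj
    obtain ⟨k, hk, rfl⟩ := exists_of_chainVec_letterA_ne_zero hj.ne'
    have key : ∀ (l : ℕ) (_ : l ≤ m), chainVec hn σ x N (letterC (nodeFin hn σ x l)
        (nodeFin hn σ x (l + 1)) (nodeFin_lt x x (by omega) (by omega))) = 1 := by
      intro l hl
      have hlt : nodeFin hn σ x l < nodeFin hn σ x (l + 1) := nodeFin_lt x x (by omega) (by omega)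
      have h1 := (chainVec_letterC (N := N) (h := hlt)).1.2 ⟨l, hl, rfl, rfl⟩
      have h2 := (chainVec_letterC (hn := hn) (σ := σ) (x := x) (N := N) (h := hlt)).2
      omega
    exact ⟨fun _ => ⟨_, _, key k (by omega)⟩, fun _ => ⟨_, _, key (k + 1) (by omega)⟩⟩

/-- A letter of the word `u` is `a_i` or an edge at `i`. -/
def Touches {n : ℕ} (u : List (UnivLetter n)) (i : Fin n) : Prop :=
  letterA i ∈ u ∨ (∃ (j : Fin n) (h : i < j), letterC i j h ∈ u) ∨
    ∃ (j : Fin n) (h : j < i), letterC j i h ∈ u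

theorem Touches.mono {u v : List (UnivLetter n)} (huv : u ⊆ v) {i : Fin n} (h : Touches u i) :
    Touches v i := by
  rcases h with h | ⟨j, hj, h⟩ | ⟨j, hj, h⟩
  · exact Or.inl (huv h)
  · exact Or.inr (Or.inl ⟨j, hj, huv h⟩)
  · exact Or.inr (Or.inr ⟨j, hj, huv h⟩)

theorem mem_iff_parikhVector_pos {α : Type} [DecidableEq α] {w : List α} {a : α} :
    a ∈ w ↔ 0 < parikhVector w a :=
  List.count_pos_iff.symm

/-- If the prefix of a word for the chain `x` and the suffix of a word for the chain `y` make up a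
word with Parikh image in `U_n`, then the two chains agree at a node touched by both parts. -/
theorem nodeFin_eq_of_mixed {x y : Fin m → Fin Q} {N N' : ℕ} {u u' v v' : List (UnivLetter n)}
    (hx : parikhVector (u ++ u') = chainVec hn σ x N)
    (hy : parikhVector (v' ++ v) = chainVec hn σ y N')
    (hU : parikhVector (u ++ v) ∈ universalOneCounterSet n) {k : ℕ} (hk : k ≤ m + 1)
    (hu : Touches u (nodeFin hn σ x k)) (hv : Touches v (nodeFin hn σ y k)) :
    nodeFin hn σ x k = nodeFin hn σ y k := by
  obtain ⟨⟨h01, t, p, hp, hp0, hpt, hpe⟩, -, hcomp⟩ := hU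
  have hmem : ∀ i j h, letterC i j h ∈ u ++ v ↔ ∃ s : Fin t, p s.castSucc = i ∧ p s.succ = j := by
    intro i j h
    rw [← hpe i j h, mem_iff_parikhVector_pos]
    have := h01 i j h
    omega
  -- A touched node lies on the path: as an endpoint if an edge letter occurs, by compatibility if
  -- a_i occurs.
  have hon : ∀ i, Touches (u ++ v) i → ∃ s, p s = i := by
    rintro i (h | ⟨j, hj, h⟩ | ⟨j, hj, h⟩)
    · rcases Nat.eq_zero_or_pos (i : ℕ) with h0 | h0
      · exact ⟨0, Fin.ext (by rw [hp0, h0])⟩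
      · obtain ⟨j, hj, h1⟩ := (hcomp i (mem_iff_parikhVector_pos.1 h)).1 h0
        obtain ⟨s, -, hs⟩ := (hpe j i hj).1 h1
        exact ⟨_, hs⟩
    · obtain ⟨s, hs, -⟩ := (hmem _ _ _).1 h
      exact ⟨_, hs⟩
    · obtain ⟨s, -, hs⟩ := (hmem _ _ _).1 h
      exact ⟨_, hs⟩
  -- Each edge of the mixed path belongs to one of the two chains and climbs exactly one level, so
  -- the s-th node of the path has level s. Two touched nodes of level k are therefore the same node
  -- of the path.
  have hlevel : ∀ s : ℕ, ∀ hs : s < t + 1, s ≤ m + 1 ∧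
      ∃ z : Fin m → Fin Q, p ⟨s, hs⟩ = nodeFin hn σ z s := by
    intro s
    induction s with
    | zero =>
      intro hs
      refine ⟨by omega, x, Fin.ext ?_⟩
      simpa [nodeFin, chainNode] using hp0
    | succ s ih =>
      intro hs
      obtain ⟨hsm, z, hz⟩ := ih (by omega)
      have hlt : p ⟨s, by omega⟩ < p ⟨s + 1, hs⟩ := hp (by simp)
      have hc : letterC _ _ hlt ∈ u ++ v := (hmem _ _ hlt).2 ⟨⟨s, by omega⟩, rfl, rfl⟩
      have : ∃ z' : Fin m → Fin Q, ∃ l ≤ m, nodeFin hn σ z' l = p ⟨s, by omega⟩ ∧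
          nodeFin hn σ z' (l + 1) = p ⟨s + 1, hs⟩ := by
        rcases List.mem_append.1 hc with hc | hc
        · refine ⟨x, (chainVec_letterC (N := N) (h := hlt)).1.1 ?_⟩
          rw [← hx, ← mem_iff_parikhVector_pos]
          exact List.mem_append_left _ hc
        · refine ⟨y, (chainVec_letterC (N := N') (h := hlt)).1.1 ?_⟩
          rw [← hy, ← mem_iff_parikhVector_pos]
          exact List.mem_append_right _ hc
      obtain ⟨z', l, hl, h1, h2⟩ := this
      have hls : l = s := nodeFin_level z' z (by omega) hsm (h1.trans hz)
      subst hls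
      exact ⟨by omega, z', h2.symm⟩
  obtain ⟨s, hs⟩ := hon _ (hu.mono (List.subset_append_left u v))
  obtain ⟨s', hs'⟩ := hon _ (hv.mono (List.subset_append_right u v))
  obtain ⟨a1, z, a2⟩ := hlevel s s.2
  obtain ⟨b1, z', b2⟩ := hlevel s' s'.2
  have e1 := nodeFin_level z x a1 hk (a2.symm.trans hs)
  have e2 := nodeFin_level z' y b1 hk (b2.symm.trans hs')
  rw [← hs, ← hs', Fin.ext (e1.trans e2.symm)]

end

/-! ### Windows of words and runs of NFAs -/

theorem parikhVector_append {α : Type} [DecidableEq α] (u v : List α) (a : α) :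
    parikhVector (u ++ v) a = parikhVector u a + parikhVector v a :=
  List.count_append

theorem sum_parikhVector_le_length {α : Type} [DecidableEq α] (T : Finset α) (w : List α) :
    ∑ a ∈ T, parikhVector w a ≤ w.length := by
  unfold parikhVector
  induction w with
  | nil => simp
  | cons b w ih =>
    simp only [List.count_cons, Finset.sum_add_distrib, List.length_cons]
    have : ∑ a ∈ T, (if (b == a) = true then 1 else 0) ≤ 1 := by
      simp only [beq_iff_eq, Finset.sum_ite_eq]
      split_ifs <;> omega
    omega

theorem sum_parikhVector_windows {α : Type} [DecidableEq α] (w : List α) (a : α) (L R : ℕ)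
    (h : w.length ≤ R * L) :
    ∑ r ∈ Finset.range R, parikhVector ((w.drop (r * L)).take L) a = parikhVector w a := by
  unfold parikhVector
  have key : ∀ R, ∑ r ∈ Finset.range R, ((w.drop (r * L)).take L).count a =
      (w.take (R * L)).count a := by
    intro R
    induction R with
    | zero => simp
    | succ R ih =>
      rw [Finset.sum_range_succ, ih, Nat.succ_mul, List.take_add, List.count_append]
  rw [key, List.take_of_length_le h]

theorem NFA.exists_states {α S : Type} (M : NFA α S) (w : List α) (q q' : S)
    (h : q' ∈ M.evalFrom {q} w) :
    ∃ ρ : ℕ → S, ρ 0 = q ∧ (∀ i, w.length ≤ i → ρ i = q') ∧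
      ∀ i j, i ≤ j → ρ j ∈ M.evalFrom {ρ i} ((w.drop i).take (j - i)) := by
  induction w generalizing q with
  | nil =>
    simp only [NFA.evalFrom_nil, Set.mem_singleton_iff] at h
    exact ⟨fun _ => q, rfl, fun _ _ => h.symm, fun i j _ => by simp⟩
  | cons a w ih =>
    rw [NFA.evalFrom_cons, NFA.stepSet_singleton, NFA.mem_evalFrom_iff_exists] at h
    obtain ⟨q₁, hq₁, h⟩ := h
    obtain ⟨ρ, h0, hend, hρ⟩ := ih q₁ h
    refine ⟨fun i => Nat.casesOn i q ρ, rfl, ?_, ?_⟩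
    · intro i hi
      obtain ⟨i, rfl⟩ : ∃ i', i = i' + 1 := ⟨i - 1, by simp at hi; omega⟩
      exact hend i (by simpa using hi)
    · intro i j hij
      rcases i with _ | i <;> rcases j with _ | j
      · simp
      · simp only [List.drop_zero, Nat.sub_zero, List.take_succ_cons, NFA.evalFrom_cons,
          NFA.stepSet_singleton]
        rw [NFA.mem_evalFrom_iff_exists]
        refine ⟨q₁, hq₁, ?_⟩
        have := hρ 0 j (Nat.zero_le _)
        rwa [h0, List.drop_zero, Nat.sub_zero] at this
      · omega
      · have := hρ i j (by omega)
        rw [List.drop_succ_cons, Nat.add_sub_add_right]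
        exact this

theorem NFA.append_mem_accepts {α S : Type} (M : NFA α S) {u v : List α} {q : S}
    (hu : q ∈ M.evalFrom M.start u) (hv : v ∈ M.acceptsFrom {q}) : u ++ v ∈ M.accepts := by
  rw [NFA.accepts_eq_acceptsFrom_start, NFA.append_mem_acceptsFrom]
  rw [NFA.mem_acceptsFrom] at hv ⊢
  obtain ⟨s, hs, hs'⟩ := hv
  exact ⟨s, hs, NFA.mem_evalFrom_iff_exists.2 ⟨q, hu, hs'⟩⟩

theorem NFA.mem_evalFrom_append {α S : Type} (M : NFA α S) {u v : List α} {T : Set S} {q q' : S}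
    (hu : q ∈ M.evalFrom T u) (hv : q' ∈ M.evalFrom {q} v) : q' ∈ M.evalFrom T (u ++ v) := by
  rw [NFA.evalFrom_append]
  exact NFA.mem_evalFrom_iff_exists.2 ⟨q, hu, hv⟩

/-- A word from `q` to `q'` can be completed to an accepted word by a bounded number of letters. -/
theorem NFA.exists_completion {α S : Type} [Fintype S] (M : NFA α S) :
    ∃ e : ℕ, ∀ (u z v : List α) (q q' : S), q ∈ M.evalFrom M.start u → q' ∈ M.evalFrom {q} z →
      v ∈ M.acceptsFrom {q'} →
      ∃ u' v' : List α, u' ++ z ++ v' ∈ M.accepts ∧ u'.length + v'.length ≤ e := by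
  classical
  have h1 : ∀ q, ∃ u', ∀ u, q ∈ M.evalFrom M.start u → q ∈ M.evalFrom M.start u' := by
    intro q
    by_cases h : ∃ u, q ∈ M.evalFrom M.start u
    · exact ⟨h.choose, fun _ _ => h.choose_spec⟩
    · exact ⟨[], fun u hu => absurd ⟨u, hu⟩ h⟩
  have h2 : ∀ q, ∃ v', ∀ v, v ∈ M.acceptsFrom {q} → v' ∈ M.acceptsFrom {q} := by
    intro q
    by_cases h : ∃ v, v ∈ M.acceptsFrom {q}
    · exact ⟨h.choose, fun _ _ => h.choose_spec⟩
    · exact ⟨[], fun u hu => absurd ⟨u, hu⟩ h⟩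
  choose f hf using h1
  choose g hg using h2
  -- One access word and one exit word are fixed per state, so the bound depends on the automaton
  -- alone.
  refine ⟨∑ q, (f q).length + ∑ q, (g q).length, fun u z v q q' hu hz hv =>
    ⟨f q, g q', M.append_mem_accepts (M.mem_evalFrom_append (hf q u hu) hz) (hg q' v hv), ?_⟩⟩
  exact Nat.add_le_add
    (Finset.single_le_sum (f := fun q => (f q).length) (fun _ _ => Nat.zero_le _) (Finset.mem_univ q))
    (Finset.single_le_sum (f := fun q => (g q).length) (fun _ _ => Nat.zero_le _) (Finset.mem_univ q'))

section

variable {n m Q : ℕ} {σ : ℕ → ℤ}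

/-- A suffix sum is the total 0 minus a nonnegative prefix sum. -/
theorem sum_neg_one_pow_Ici_nonpos {v : UnivLetter n → ℕ} (hv : v ∈ universalOneCounterSet n)
    {X : Fin n} (hX : 0 < (X : ℕ)) :
    ∑ i ∈ Finset.Ici X, (-1 : ℤ) ^ (i : ℕ) * (v (letterA i) : ℤ) ≤ 0 := by
  obtain ⟨-, ⟨h0, hpre⟩, -⟩ := hv
  have hX' := X.2
  have h1 := hpre ⟨X - 1, by omega⟩ (by simp only; omega)
  rw [← Finset.sum_filter_add_sum_filter_not _ (fun i => X ≤ i)] at h0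
  have e1 : (Finset.univ.filter fun i => X ≤ i) = Finset.Ici X := by ext; simp
  have e2 : (Finset.univ.filter fun i => ¬ X ≤ i) = Finset.Iic ⟨X - 1, by omega⟩ := by
    ext i
    simp only [Finset.mem_filter, Finset.mem_univ, true_and, Finset.mem_Iic, Fin.le_def]
    omega
  rw [e1, e2] at h0
  linarith

theorem neg_length_le_sum_neg_one_pow (u : List (UnivLetter n)) (T : Finset (Fin n)) :
    -(u.length : ℤ) ≤ ∑ i ∈ T, (-1 : ℤ) ^ (i : ℕ) * (parikhVector u (letterA i) : ℤ) := by
  have h1 : ∑ i ∈ T, parikhVector u (letterA i) ≤ u.length := by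
    have := sum_parikhVector_le_length (T.map ⟨letterA, Sum.inr_injective⟩) u
    rw [Finset.sum_map] at this
    exact this
  have h2 : ∑ i ∈ T, -(parikhVector u (letterA i) : ℤ) ≤
      ∑ i ∈ T, (-1 : ℤ) ^ (i : ℕ) * (parikhVector u (letterA i) : ℤ) := by
    refine Finset.sum_le_sum fun i _ => ?_
    rcases neg_one_pow_eq_or ℤ (i : ℕ) with h | h <;> rw [h] <;> omega
  rw [Finset.sum_neg_distrib] at h2
  have h3 : ((∑ i ∈ T, parikhVector u (letterA i) : ℕ) : ℤ) ≤ u.length := by exact_mod_cast h1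
  push_cast at h3
  linarith

/-- Windows of a word for a chain are balanced up to the length of the completion. -/
theorem window_balance {hn : 2 * Q * m + 3 ≤ n} (hσ : ∀ k < m, σ k = 1 ∨ σ k = -1)
    (x : Fin m → Fin Q) {u z v : List (UnivLetter n)} {e : ℕ}
    (hU : parikhVector (u ++ z ++ v) ∈ universalOneCounterSet n) (hlen : u.length + v.length ≤ e)
    (hz : ∀ i, letterA i ∈ z → ∃ k < m, nodeFin hn σ x (k + 1) = i) {k₀ : ℕ} (hk₀ : k₀ < m) :
    ∑ k ∈ Finset.Ico k₀ m, σ k * (parikhVector z (letterA (nodeFin hn σ x (k + 1))) : ℤ) ≤ e := by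
  have hpos : 0 < ((nodeFin hn σ x (k₀ + 1) : Fin n) : ℕ) :=
    lt_of_le_of_lt (Nat.zero_le _)
      (Fin.lt_def.1 (nodeFin_lt (hn := hn) (σ := σ) x x (Nat.succ_pos k₀) (by omega)))
  have h1 := sum_neg_one_pow_Ici_nonpos hU hpos
  simp only [parikhVector_append, Nat.cast_add, mul_add, Finset.sum_add_distrib] at h1
  have hu := neg_length_le_sum_neg_one_pow u (Finset.Ici (nodeFin hn σ x (k₀ + 1)))
  have hv := neg_length_le_sum_neg_one_pow v (Finset.Ici (nodeFin hn σ x (k₀ + 1)))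
  rw [sum_neg_one_pow_nodes hσ x (fun i => (parikhVector z (letterA i) : ℤ)) (fun i hi =>
    hz i (mem_iff_parikhVector_pos.2 (Nat.pos_of_ne_zero (by exact_mod_cast hi))))] at h1
  have h2 : ∑ k ∈ Finset.Ico k₀ m, σ k * (parikhVector z (letterA (nodeFin hn σ x (k + 1))) : ℤ) =
      ∑ k ∈ Finset.range m, if nodeFin hn σ x (k + 1) ∈ Finset.Ici (nodeFin hn σ x (k₀ + 1))
        then σ k * (parikhVector z (letterA (nodeFin hn σ x (k + 1))) : ℤ) else 0 := by
    rw [← Finset.sum_filter]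
    refine Finset.sum_congr ?_ fun _ _ => rfl
    ext k
    simp only [Finset.mem_Ico, Finset.mem_filter, Finset.mem_range, Finset.mem_Ici]
    constructor
    · rintro ⟨a, b⟩
      exact ⟨b, (nodeFin_le_iff x (by omega) (by omega)).2 (by omega)⟩
    · rintro ⟨a, b⟩
      have := (nodeFin_le_iff x (by omega) (by omega)).1 b
      exact ⟨by omega, a⟩
  rw [h2]
  have : (u.length : ℤ) + v.length ≤ e := by exact_mod_cast hlen
  linarith

theorem length_eq_sum_parikhVector {α : Type} [DecidableEq α] [Fintype α] (w : List α) :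
    w.length = ∑ a, parikhVector w a := by
  unfold parikhVector
  induction w with
  | nil => simp
  | cons b w ih => simp [List.count_cons, Finset.sum_add_distrib, ih]

theorem length_le_of_parikhVector_eq_chainVec {hn : 2 * Q * m + 3 ≤ n} {x : Fin m → Fin Q} {N : ℕ}
    {w : List (UnivLetter n)} (hw : parikhVector w = chainVec hn σ x N) :
    w.length ≤ n * n + n * N := by
  rw [length_eq_sum_parikhVector, hw, Fintype.sum_sum_type]
  refine Nat.add_le_add ?_ ?_
  · refine (Finset.sum_le_card_nsmul _ _ 1 fun a _ => ?_).trans ?_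
    · exact (chainVec_letterC (h := a.2)).2
    · rw [smul_eq_mul, mul_one, Finset.card_univ]
      refine (Fintype.card_subtype_le _).trans ?_
      simp
  · refine (Finset.sum_le_card_nsmul _ _ N fun a _ => ?_).trans ?_
    · simp only [chainVec, Sum.elim_inr]
      split_ifs <;> omega
    · simp

end

theorem List.mem_take_of_mem_window {α : Type} {w : List α} {a : α} {t L T : ℕ} (h : t + L ≤ T)
    (ha : a ∈ (w.drop t).take L) : a ∈ w.take T := by
  rw [show T = t + (T - t) by omega, List.take_add]
  refine List.mem_append_right _ ?_
  rw [show T - t = L + (T - t - L) by omega, List.take_add]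
  exact List.mem_append_left _ ha

theorem List.mem_drop_of_mem_window {α : Type} {w : List α} {a : α} {t L T : ℕ} (h : T ≤ t)
    (ha : a ∈ (w.drop t).take L) : a ∈ w.drop T := by
  have := List.mem_of_mem_take ha
  rw [show t = T + (t - T) by omega, ← List.drop_drop] at this
  exact List.mem_of_mem_drop this

theorem NFA.exists_run {α S : Type} (M : NFA α S) {w : List α} (hw : w ∈ M.accepts) :
    ∃ ρ : ℕ → S, (∀ i, ρ i ∈ M.evalFrom M.start (w.take i)) ∧
      (∀ i, w.drop i ∈ M.acceptsFrom {ρ i}) ∧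
      ∀ i j, i ≤ j → ρ j ∈ M.evalFrom {ρ i} ((w.drop i).take (j - i)) := by
  rw [NFA.mem_accepts] at hw
  obtain ⟨s, hs, hw⟩ := hw
  obtain ⟨q, hq, hw⟩ := NFA.mem_evalFrom_iff_exists.1 hw
  obtain ⟨ρ, h0, hend, hρ⟩ := M.exists_states w q s hw
  refine ⟨ρ, fun i => ?_, fun i => ?_, hρ⟩
  · have := hρ 0 i (Nat.zero_le _)
    rw [h0, List.drop_zero, Nat.sub_zero] at this
    exact NFA.mem_evalFrom_iff_exists.2 ⟨q, hq, this⟩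
  · have := hρ i (i + w.length) (by omega)
    rw [hend (i + w.length) (by omega), List.take_of_length_le (by rw [List.length_drop]; omega)] at this
    exact NFA.mem_acceptsFrom.2 ⟨s, hs, this⟩

/-! ### The cut of an accepting run and the count of states -/

section

variable {n m Q : ℕ} {σ : ℕ → ℤ}

/-- The number of windows is chosen such that the total error is small. -/
theorem window_parameters {n e L N a : ℕ} (hn : 0 < n) (hL : L = 2 * e * n + 1)
    (hN : N = n + 2 * e + 2 * a + 1) :
    n * n + n * N ≤ ((n * n + n * N) / L + 1) * L ∧
      e * ((n * n + n * N) / L + 1) + a < N := by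
  have hLpos : 0 < L := by omega
  have h1 := Nat.div_add_mod (n * n + n * N) L
  have h2 := Nat.mod_lt (n * n + n * N) hLpos
  set D := (n * n + n * N) / L with hD
  refine ⟨by nlinarith, ?_⟩
  -- As L > 2en, the error eD of the windows is at most (n + N)/2; N is large enough for its other
  -- half to absorb the remaining terms.
  have h3 : n * (2 * e * D) ≤ n * (n + N) := by
    calc n * (2 * e * D) = 2 * e * n * D := by ring
      _ ≤ L * D := Nat.mul_le_mul_right _ (by omega)
      _ ≤ n * (n + N) := by rw [mul_add]; omega
  have h4 := Nat.le_of_mul_le_mul_left h3 hn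
  have h5 : 2 * (e * (D + 1)) = 2 * e * D + 2 * e := by ring
  omega

theorem card_le_of_adjacent (A J : Finset ℕ) (h : ∀ i ∈ A, i ∈ J ∨ i + 1 ∈ J) :
    A.card ≤ 2 * J.card := by
  have h1 : A ⊆ J ∪ J.image fun i => i - 1 := by
    intro i hi
    rcases h i hi with h | h
    · exact Finset.mem_union_left _ h
    · exact Finset.mem_union_right _ (Finset.mem_image.2 ⟨i + 1, h, by simp⟩)
  have h2 := Finset.card_le_card h1
  have h3 := Finset.card_union_le J (J.image fun i => i - 1)
  have h4 : (J.image fun i => i - 1).card ≤ J.card := Finset.card_image_le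
  omega

/-- If the endpoints of an edge occur on different sides of a cut, then one of them is touched by
both sides. -/
theorem touches_of_alternation {hn : 2 * Q * m + 3 ≤ n} {x : Fin m → Fin Q} {N i : ℕ}
    {u v : List (UnivLetter n)} (hw : parikhVector (u ++ v) = chainVec hn σ x N) (hi : i + 1 < m)
    (h : (letterA (nodeFin hn σ x (i + 1)) ∈ u ∧ letterA (nodeFin hn σ x (i + 2)) ∈ v) ∨
      (letterA (nodeFin hn σ x (i + 1)) ∈ v ∧ letterA (nodeFin hn σ x (i + 2)) ∈ u)) :
    (Touches u (nodeFin hn σ x (i + 1)) ∧ Touches v (nodeFin hn σ x (i + 1))) ∨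
      (Touches u (nodeFin hn σ x (i + 2)) ∧ Touches v (nodeFin hn σ x (i + 2))) := by
  have hlt : nodeFin hn σ x (i + 1) < nodeFin hn σ x (i + 2) :=
    nodeFin_lt x x (by omega) (by omega)
  have hc : letterC _ _ hlt ∈ u ++ v := by
    rw [mem_iff_parikhVector_pos, hw]
    exact chainVec_letterC.1.2 ⟨i + 1, by omega, rfl, rfl⟩
  have t1 : ∀ z : List (UnivLetter n), letterC _ _ hlt ∈ z → Touches z (nodeFin hn σ x (i + 1)) :=
    fun z hz => Or.inr (Or.inl ⟨_, hlt, hz⟩)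
  have t2 : ∀ z : List (UnivLetter n), letterC _ _ hlt ∈ z → Touches z (nodeFin hn σ x (i + 2)) :=
    fun z hz => Or.inr (Or.inr ⟨_, hlt, hz⟩)
  rcases List.mem_append.1 hc with hc | hc <;> rcases h with ⟨h1, h2⟩ | ⟨h1, h2⟩
  · exact Or.inr ⟨t2 _ hc, Or.inl h2⟩
  · exact Or.inl ⟨t1 _ hc, Or.inl h1⟩
  · exact Or.inl ⟨Or.inl h1, t1 _ hc⟩
  · exact Or.inr ⟨Or.inl h2, t2 _ hc⟩

/-- An accepting run for a chain whose nodes form a word that is hard to re-pair has a cut such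
that many nodes are touched by both sides. -/
theorem exists_touched_nodes {S : Type} [Fintype S] (hn : 2 * Q * m + 3 ≤ n)
    (hσ : ∀ k < m, σ k = 1 ∨ σ k = -1) (h0 : ∀ k ≤ m, 0 ≤ height σ k) (hm : height σ m = 0) {A : ℕ}
    (hA : ∀ π τ, RePairing σ m π τ → ∃ r, A ≤ alternations τ r 0 m) (M : NFA (UnivLetter n) S)
    (hM : parikhImage M.accepts = universalOneCounterSet n) :
    ∃ N, ∀ x : Fin m → Fin Q, ∃ (q : S) (u v : List (UnivLetter n)),
      q ∈ M.evalFrom M.start u ∧ v ∈ M.acceptsFrom {q} ∧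
      parikhVector (u ++ v) = chainVec hn σ x N ∧
      ∃ J : Finset (Fin m), A ≤ 2 * J.card ∧ ∀ k ∈ J,
        Touches u (nodeFin hn σ x (k + 1)) ∧ Touches v (nodeFin hn σ x (k + 1)) := by
  classical
  obtain ⟨e, he⟩ := M.exists_completion
  -- The constant e does not depend on the chain or on N, so L, N and R can be chosen after it.
  obtain ⟨L, hL⟩ : ∃ L, L = 2 * e * n + 1 := ⟨_, rfl⟩
  obtain ⟨N, hN⟩ : ∃ N, N = n + 2 * e + 2 * (m ^ 3 * L) + 1 := ⟨_, rfl⟩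
  obtain ⟨hlen, hbig⟩ := window_parameters (by omega) hL hN
  obtain ⟨R, hR⟩ : ∃ R, R = (n * n + n * N) / L + 1 := ⟨_, rfl⟩
  rw [← hR] at hlen hbig
  refine ⟨N, fun x => ?_⟩
  obtain ⟨w, hw, hwx⟩ : chainVec hn σ x N ∈ parikhImage M.accepts :=
    hM ▸ chainVec_mem hσ h0 hm x N
  obtain ⟨ρ, hρs, hρa, hρ⟩ := M.exists_run hw
  have hwlen := (length_le_of_parikhVector_eq_chainVec hwx).trans hlen
  obtain ⟨π, τ, hre, hτ⟩ := exists_rePairing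
    (cnt := fun r k => parikhVector ((w.drop (r * L)).take L) (letterA (nodeFin hn σ x (k + 1))))
    (σ := σ) (m := m) (N := N) (L := L) (e := e) (R := R) hσ hm
    (fun k hk => by
      rw [sum_parikhVector_windows w _ L R hwlen, hwx, chainVec_letterA_node hk])
    (fun r _ => by
      have h1 := sum_parikhVector_le_length
        ((Finset.range m).image fun k => letterA (nodeFin hn σ x (k + 1))) ((w.drop (r * L)).take L)
      rw [Finset.sum_image] at h1
      · exact h1.trans (List.length_take_le _ _)
      · intro k hk k' hk' h
        simp only [Finset.coe_range, Set.mem_Iio] at hk hk'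
        have := nodeFin_level x x (by omega) (by omega) (Sum.inr_injective h)
        omega)
    (fun r _ k₀ hk₀ => by
      have h1 := hρ (r * L) (r * L + L) (by omega)
      rw [Nat.add_sub_cancel_left] at h1
      obtain ⟨u', v', hacc, hlen'⟩ := he _ _ _ _ _ (hρs (r * L)) h1 (hρa (r * L + L))
      refine window_balance hσ x (hM ▸ ⟨_, hacc, rfl⟩) hlen' (fun i hi => ?_) hk₀
      have hi' := List.mem_of_mem_drop (List.mem_of_mem_take hi)
      rw [mem_iff_parikhVector_pos, hwx] at hi'
      exact exists_of_chainVec_letterA_ne_zero hi'.ne')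
    hbig
  obtain ⟨r, hr⟩ := hA π τ hre
  have hmem : ∀ k < m,
      letterA (nodeFin hn σ x (k + 1)) ∈ (w.drop (τ k * L)).take L := fun k hk =>
    mem_iff_parikhVector_pos.2 (hτ k hk).2
  -- A bracket erased before time r occurs in a window that ends by the cut r * L; any other one
  -- occurs in a window that starts at or after it.
  have hu : ∀ k < m, τ k < r → letterA (nodeFin hn σ x (k + 1)) ∈ w.take (r * L) := by
    intro k hk hkr
    refine List.mem_take_of_mem_window ?_ (hmem k hk)
    rw [← Nat.succ_mul]
    exact Nat.mul_le_mul_right L hkr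
  have hv : ∀ k < m, ¬ τ k < r → letterA (nodeFin hn σ x (k + 1)) ∈ w.drop (r * L) := by
    intro k hk hkr
    exact List.mem_drop_of_mem_window (Nat.mul_le_mul_right L (not_lt.1 hkr)) (hmem k hk)
  have hsplit : parikhVector (w.take (r * L) ++ w.drop (r * L)) = chainVec hn σ x N := by
    rw [List.take_append_drop, hwx]
  refine ⟨ρ (r * L), w.take (r * L), w.drop (r * L), hρs _, hρa _, hsplit,
    Finset.univ.filter fun k : Fin m => Touches (w.take (r * L)) (nodeFin hn σ x (k + 1)) ∧
      Touches (w.drop (r * L)) (nodeFin hn σ x (k + 1)), ?_, fun k hk => (Finset.mem_filter.1 hk).2⟩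
  refine hr.trans ?_
  rw [← Finset.card_map Fin.valEmbedding]
  refine card_le_of_adjacent _ _ fun i hi => ?_
  simp only [Finset.mem_filter, Finset.mem_range, zero_add] at hi
  obtain ⟨hi1, hi2⟩ := hi
  have him : i + 1 < m := by omega
  rcases touches_of_alternation hsplit him (by
    by_cases h1 : τ i < r
    · have h2 : ¬ τ (i + 1) < r := fun h2 => hi2 (iff_of_true h1 h2)
      exact Or.inl ⟨hu i (by omega) h1, hv (i + 1) him h2⟩
    · have h2 : τ (i + 1) < r := by
        by_contra h2
        exact hi2 (iff_of_false h1 h2)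
      exact Or.inr ⟨hv i (by omega) h1, hu (i + 1) him h2⟩) with h | h
  · exact Or.inl (Finset.mem_map.2 ⟨⟨i, by omega⟩, by simpa using h, rfl⟩)
  · exact Or.inr (Finset.mem_map.2 ⟨⟨i + 1, him⟩, by simpa using h, rfl⟩)

/-- The number of states is bounded below by a power of the number of candidates for a node. -/
theorem pow_le_card_mul_pow {S : Type} [Fintype S] (hn : 2 * Q * m + 3 ≤ n) (hQ : 0 < Q)
    (hσ : ∀ k < m, σ k = 1 ∨ σ k = -1) (h0 : ∀ k ≤ m, 0 ≤ height σ k) (hm : height σ m = 0) {A : ℕ}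
    (hA : ∀ π τ, RePairing σ m π τ → ∃ r, 2 * A ≤ alternations τ r 0 m + 1)
    (M : NFA (UnivLetter n) S) (hM : parikhImage M.accepts = universalOneCounterSet n) :
    Q ^ A ≤ Fintype.card S * m ^ A := by
  classical
  obtain ⟨N, hN⟩ := exists_touched_nodes (A := 2 * A - 1) hn hσ h0 hm
    (fun π τ h => (hA π τ h).imp fun r hr => by omega) M hM
  choose q u v hu hv hw J hJ hJt using hN
  -- Trimming to exactly A nodes bounds the number of possible sets by m^A.
  have hT : ∀ x, ∃ T ⊆ J x, T.card = A := fun x =>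
    Finset.exists_subset_card_eq (by have := hJ x; omega)
  choose T hTJ hTA using hT
  have hagree : ∀ x y, q x = q y → T x = T y → ∀ k ∈ T x, x k = y k := by
    intro x y hq hTxy k hk
    refine eq_of_nodeFin_eq (hn := hn) (σ := σ) x y k ?_
    refine nodeFin_eq_of_mixed (hw x) (hw y) ?_ (by omega) (hJt x k (hTJ x hk)).1
      (hJt y k (hTJ y (hTxy ▸ hk))).2
    rw [← hM]
    exact ⟨_, M.append_mem_accepts (hu x) (hq ▸ hv y), rfl⟩
  have hAm : A ≤ m ∨ m < A := le_or_gt A m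
  rcases hAm with hAm | hAm
  -- For given q and T the A coordinates in T are fixed, which leaves at most Q^(m - A) chains.
  · have hcard := Finset.card_le_mul_card_image (f := fun x => (q x, T x))
      (Finset.univ : Finset (Fin m → Fin Q)) (Q ^ (m - A)) (by
        intro b hb
        obtain ⟨x₀, -, rfl⟩ := Finset.mem_image.1 hb
        have h1 : Fintype.card ({k // k ∉ T x₀} → Fin Q) = Q ^ (m - A) := by
          rw [Fintype.card_fun, Fintype.card_fin, Fintype.card_subtype_compl, Fintype.card_fin,
            Fintype.card_coe, hTA]
        rw [← h1, ← Finset.card_univ]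
        refine Finset.card_le_card_of_injOn (fun x k => x k) 
          (fun _ _ => Finset.mem_coe.2 (Finset.mem_univ _)) ?_
        intro x hx y hy hxy
        simp only [Finset.coe_filter, Finset.mem_univ, true_and, Set.mem_ofPred_eq,
          Prod.mk.injEq] at hx hy
        funext k
        by_cases hk : k ∈ T x₀
        · exact hagree x y (hx.1.trans hy.1.symm) (hx.2.trans hy.2.symm) k (hx.2 ▸ hk)
        · exact congrFun hxy ⟨k, hk⟩)
    have himg : (Finset.univ.image fun x => (q x, T x)).card ≤ Fintype.card S * m ^ A := by
      have h2 : (Finset.univ.image fun x => (q x, T x)) ⊆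
          (Finset.univ : Finset S) ×ˢ (Finset.univ : Finset (Fin m)).powersetCard A := by
        intro b hb
        obtain ⟨x₀, -, rfl⟩ := Finset.mem_image.1 hb
        simp [Finset.mem_powersetCard, hTA]
      refine (Finset.card_le_card h2).trans ?_
      rw [Finset.card_product, Finset.card_univ, Finset.card_powersetCard, Finset.card_univ,
        Fintype.card_fin]
      exact Nat.mul_le_mul_left _ (Nat.choose_le_pow m A)
    rw [Finset.card_univ, Fintype.card_fun, Fintype.card_fin, Fintype.card_fin] at hcard
    have h3 : Q ^ (m - A) * Q ^ A ≤ Q ^ (m - A) * (Fintype.card S * m ^ A) := by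
      rw [← pow_add, Nat.sub_add_cancel hAm]
      exact hcard.trans (Nat.mul_le_mul_left _ himg)
    exact Nat.le_of_mul_le_mul_left h3 (by positivity)
  · exfalso
    have h1 := hTA (fun _ => ⟨0, hQ⟩)
    have h2 := Finset.card_le_univ (T (fun _ => ⟨0, hQ⟩))
    rw [Fintype.card_fin] at h2
    omega

end

/-! ### Choice of parameters and the lower bound for NFAs -/

theorem wordLen_le {M C : ℕ} (j : ℕ) (hMC : (M + 1) ^ j ≤ C) (hC : 2 ≤ C) (i : ℕ) (hi : i ≤ j) :
    wordLen M C i ≤ (2 * C) ^ (i + 1) := by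
  induction i with
  | zero => simp only [wordLen, zero_add, pow_one]; omega
  | succ i ih =>
    have h1 : M * (M + 1) ^ i ≤ C := by
      refine le_trans ?_ hMC
      calc M * (M + 1) ^ i ≤ (M + 1) * (M + 1) ^ i := Nat.mul_le_mul_right _ (Nat.le_succ M)
        _ = (M + 1) ^ (i + 1) := by ring
        _ ≤ (M + 1) ^ j := Nat.pow_le_pow_right (Nat.succ_pos M) hi
    have h2 : C ≤ (2 * C) ^ (i + 1) :=
      le_trans (by omega) (Nat.le_self_pow (Nat.succ_ne_zero i) (2 * C))
    calc wordLen M C (i + 1) = C * (wordLen M C i + M * (M + 1) ^ i) := rfl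
      _ ≤ C * ((2 * C) ^ (i + 1) + (2 * C) ^ (i + 1)) :=
        Nat.mul_le_mul_left _ (Nat.add_le_add (ih (by omega)) (h1.trans h2))
      _ = (2 * C) ^ (i + 1 + 1) := by ring

/-- The word of level j with M = 2j + 1, whose height is at most H = (2j+2)^j. The exponent (j+2)/2
is half of its j + 1 alternations, rounded up. -/
theorem exists_hard_word (j : ℕ) (hj : 1 ≤ j) :
    ∃ m, 0 < m ∧ m ≤ (2 * j + 2) ^ ((j + 2) * (j + 1)) ∧
      ∀ (n Q : ℕ), 2 * Q * m + 3 ≤ n → 0 < Q →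
        ∀ (S : Type) [Fintype S] (M : NFA (UnivLetter n) S),
          parikhImage M.accepts = universalOneCounterSet n →
          Q ^ ((j + 2) / 2) ≤ Fintype.card S * m ^ ((j + 2) / 2) := by
  set H := (2 * j + 1 + 1) ^ j with hH
  have hHpos : 0 < H := by positivity
  set C := 2 * H + 4 with hC
  have hCe : C % 2 = 0 := by omega
  refine ⟨wordLen (2 * j + 1) C j, wordLen_pos (by omega) j, ?_, ?_⟩
  · refine (wordLen_le (M := 2 * j + 1) (C := C) j (by omega) (by omega) j le_rfl).trans ?_
    rw [pow_mul]
    refine Nat.pow_le_pow_left ?_ _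
    have h1 : 4 * 4 ≤ (2 * j + 2) * (2 * j + 2) := Nat.mul_le_mul (by omega) (by omega)
    calc 2 * C ≤ 4 * 4 * H := by omega
      _ ≤ (2 * j + 2) * (2 * j + 2) * H := Nat.mul_le_mul_right _ h1
      _ = (2 * j + 2) ^ (j + 2) := by rw [hH]; ring
  · intro n Q hn hQ S _ M hM
    obtain ⟨hb, hz⟩ := height_hardWord (M := 2 * j + 1) hCe j
    refine pow_le_card_mul_pow (σ := hardWord (2 * j + 1) C j) hn hQ
      (fun k _ => hardWord_sign j k) (fun k hk => (hb k hk).1) hz ?_ M hM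
    intro π τ hre
    obtain ⟨r, hr⟩ := hre.exists_alternations (M := 2 * j + 1) (H := H) hCe (by omega) j le_rfl 0
      (fun i _ => by rw [zero_add]) (by omega) (by simp [height, hH])
    exact ⟨r, by omega⟩

/-- For L = log n and j = ⌊q/6⌋ with q = √(L / log L), the second bound says that the eighth power
of (2j+2)^((j+2)(j+1)) is at most n. As q ≥ 12, j + 2 ≤ q/3, and 8 (q/3)^2 log L = 8L/9. -/
theorem parameters_bound {L : ℝ} (hL : 100000 ≤ L) :
    1 ≤ ⌊Real.sqrt (L / Real.log L) / 6⌋₊ ∧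
      (8 * (((⌊Real.sqrt (L / Real.log L) / 6⌋₊ : ℝ) + 2) * ((⌊Real.sqrt (L / Real.log L) / 6⌋₊ : ℝ) + 1))) *
        Real.log (2 * (⌊Real.sqrt (L / Real.log L) / 6⌋₊ : ℝ) + 2) ≤ L := by
  have hL0 : 0 < L := by linarith
  have hlog1 : 1 ≤ Real.log L := by
    rw [Real.le_log_iff_exp_le hL0]
    linarith [Real.exp_one_lt_d9]
  have hlog2 : Real.log L ≤ 2 * Real.sqrt L := by
    have h1 : Real.log L = 2 * Real.log (Real.sqrt L) := by
      rw [Real.log_sqrt hL0.le]; ring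
    have h2 := Real.log_le_sub_one_of_pos (Real.sqrt_pos.2 hL0)
    linarith
  have hsq : Real.sqrt L * Real.sqrt L = L := Real.mul_self_sqrt hL0.le
  have hs : 300 ≤ Real.sqrt L := Real.le_sqrt_of_sq_le (by linarith)
  set q := Real.sqrt (L / Real.log L) with hq
  have hqq : q * q = L / Real.log L := Real.mul_self_sqrt (by positivity)
  -- L / log L ≥ √L / 2 ≥ 150 > 12^2.
  have hq12 : 12 ≤ q := by
    refine Real.le_sqrt_of_sq_le ?_
    rw [le_div_iff₀ (by linarith)]
    nlinarith
  have hqL : q * q * Real.log L = L := by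
    rw [hqq, div_mul_cancel₀ _ (by linarith)]
  have hf1 : (⌊q / 6⌋₊ : ℝ) ≤ q / 6 := Nat.floor_le (by positivity)
  have hf0 : (0 : ℝ) ≤ ⌊q / 6⌋₊ := Nat.cast_nonneg _
  refine ⟨Nat.le_floor (by push_cast; linarith), ?_⟩
  generalize (⌊q / 6⌋₊ : ℝ) = f at hf1 hf0
  have h3 : 2 * f + 2 ≤ L := by nlinarith
  have h4 : Real.log (2 * f + 2) ≤ Real.log L := Real.log_le_log (by linarith) h3
  have h5 : (f + 2) * (f + 1) ≤ (q / 3) * (q / 3) :=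
    mul_le_mul (by linarith) (by linarith) (by linarith) (by linarith)
  have h6 : 0 ≤ Real.log (2 * f + 2) := Real.log_nonneg (by linarith)
  calc 8 * ((f + 2) * (f + 1)) * Real.log (2 * f + 2) ≤ 8 * ((q / 3) * (q / 3)) * Real.log L :=
        mul_le_mul (by linarith) h4 h6 (by positivity)
    _ = 8 / 9 * (q * q * Real.log L) := by ring
    _ = 8 / 9 * L := by rw [hqL]
    _ ≤ L := by linarith

theorem nfa_lower_bound :
    ∃ c : ℝ, 0 < c ∧ ∃ N : ℕ, ∀ n : ℕ, N ≤ n → Even n →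
      ∀ (S : Type) [Fintype S] (M : NFA (UnivLetter n) S),
        parikhImage M.accepts = universalOneCounterSet n →
        (n : ℝ) ^ (c * Real.sqrt (Real.log n / Real.log (Real.log n))) ≤ (Fintype.card S : ℝ) := by
  have hev : ∀ᶠ n : ℕ in Filter.atTop, (100000 : ℝ) ≤ Real.log n :=
    (Real.tendsto_log_atTop.comp tendsto_natCast_atTop_atTop).eventually_ge_atTop _
  obtain ⟨N, hN⟩ := Filter.eventually_atTop.1 hev
  -- Below, Q / m ≥ √n gives at least n^(A/2) states with A ≥ (j+1)/2 > q/12, hence 1/24. The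
  -- threshold 65536 = 16^4 makes the fourth root a of n at least 16.
  refine ⟨1 / 24, by norm_num, max N 65536, fun n hn _ S _ M hM => ?_⟩
  have hL := hN n (le_trans (le_max_left _ _) hn)
  have hn1 : 65536 ≤ n := le_trans (le_max_right _ _) hn
  have hnR : (65536 : ℝ) ≤ n := by exact_mod_cast hn1
  obtain ⟨hj, hbound⟩ := parameters_bound hL
  set q := Real.sqrt (Real.log n / Real.log (Real.log n)) with hq
  set j := ⌊q / 6⌋₊ with hjdef
  have hjq : q / 6 < j + 1 := Nat.lt_floor_add_one _
  obtain ⟨m, hm0, hm, hmain⟩ := exists_hard_word j hj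
  have hm8 : m ^ 8 ≤ n := by
    refine (Nat.pow_le_pow_left hm 8).trans ?_
    rw [← pow_mul]
    have h1 : Real.log (((2 * j + 2) ^ ((j + 2) * (j + 1) * 8) : ℕ) : ℝ) ≤ Real.log n := by
      push_cast
      rw [Real.log_pow]
      push_cast
      linarith
    have h2 := (Real.log_le_log_iff (by positivity) (by linarith)).1 h1
    exact_mod_cast h2
  have hm1 : (1 : ℝ) ≤ m := by exact_mod_cast hm0
  have hm8R : (m : ℝ) ^ 8 ≤ n := by exact_mod_cast hm8
  have hm2 : (m : ℝ) ^ 2 ≤ Real.sqrt (Real.sqrt n) :=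
    Real.le_sqrt_of_sq_le (Real.le_sqrt_of_sq_le (by
      calc (((m : ℝ) ^ 2) ^ 2) ^ 2 = (m : ℝ) ^ 8 := by ring
        _ ≤ (n : ℝ) := hm8R))
  set a := Real.sqrt (Real.sqrt n) with ha
  have ha4 : a ^ 4 = n := by
    calc a ^ 4 = (a ^ 2) ^ 2 := by ring
      _ = (n : ℝ) := by rw [ha, Real.sq_sqrt (Real.sqrt_nonneg _), Real.sq_sqrt (by positivity)]
  have ha16 : 16 ≤ a :=
    Real.le_sqrt_of_sq_le (Real.le_sqrt_of_sq_le (by norm_num; linarith))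
  have hma : (m : ℝ) ≤ a := le_trans (by nlinarith) hm2
  obtain ⟨Q, hQdef⟩ : ∃ Q, Q = (n - 3) / (2 * m) := ⟨_, rfl⟩
  have hQ1 : 2 * Q * m + 3 ≤ n := by
    have := Nat.div_mul_le_self (n - 3) (2 * m)
    rw [← hQdef] at this
    have e : 2 * Q * m = Q * (2 * m) := by ring
    omega
  have hQ2 : n < 2 * Q * m + 2 * m + 3 := by
    have := Nat.lt_div_mul_add (a := n - 3) (b := 2 * m) (by omega)
    rw [← hQdef] at this
    have e : 2 * Q * m = Q * (2 * m) := by ring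
    omega
  have hQ2R : (n : ℝ) < 2 * Q * m + 2 * m + 3 := by exact_mod_cast hQ2
  -- Since m^2 ≤ a, failure would give Qm ≤ a^3, too little for 2Qm + 2m + 3 > n = a^4 ≥ 16 a^3.
  have hQm : a ^ 2 * m ≤ Q := by
    by_contra hcon
    push Not at hcon
    have h1 : (Q : ℝ) * m ≤ a ^ 2 * m * m := mul_le_mul_of_nonneg_right hcon.le (by positivity)
    have h2 : a ^ 2 * m * m ≤ a ^ 3 := by
      calc a ^ 2 * m * m = a ^ 2 * (m : ℝ) ^ 2 := by ring
        _ ≤ a ^ 2 * a := mul_le_mul_of_nonneg_left hm2 (by positivity)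
        _ = a ^ 3 := by ring
    have h3 : 16 * a ^ 3 ≤ a ^ 4 := by
      calc 16 * a ^ 3 ≤ a * a ^ 3 := mul_le_mul_of_nonneg_right ha16 (by positivity)
        _ = a ^ 4 := by ring
    have h4 : a ≤ a ^ 3 := by nlinarith [sq_nonneg a]
    nlinarith
  have hQ0 : 0 < Q := by
    have : (0 : ℝ) < Q := lt_of_lt_of_le (by positivity) hQm
    exact_mod_cast this
  have hfin := hmain n Q hQ1 hQ0 S M hM
  obtain ⟨A, hA⟩ : ∃ A, A = (j + 2) / 2 := ⟨_, rfl⟩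
  rw [← hA] at hfin
  have hfinR : (Q : ℝ) ^ A ≤ Fintype.card S * (m : ℝ) ^ A := by exact_mod_cast hfin
  have hpow : (a ^ 2) ^ A ≤ (Fintype.card S : ℝ) := by
    have h1 : (a ^ 2) ^ A * (m : ℝ) ^ A ≤ Fintype.card S * (m : ℝ) ^ A := by
      rw [← mul_pow]
      exact (pow_le_pow_left₀ (by positivity) hQm A).trans hfinR
    exact le_of_mul_le_mul_right h1 (by positivity)
  refine le_trans ?_ hpow
  have hexp : (a ^ 2) ^ A = (n : ℝ) ^ ((A : ℝ) / 2) := by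
    have : a ^ 2 = (n : ℝ) ^ (1 / 2 : ℝ) := by
      rw [ha, Real.sq_sqrt (Real.sqrt_nonneg _), Real.sqrt_eq_rpow]
    rw [this, ← Real.rpow_natCast, ← Real.rpow_mul (by positivity)]
    congr 1; ring
  rw [hexp]
  refine Real.rpow_le_rpow_of_exponent_le (by linarith) ?_
  have hAj : ((j : ℝ) + 1) ≤ 2 * A := by
    have : j + 1 ≤ 2 * A := by omega
    exact_mod_cast this
  linarith

/-! ### The one-counter automaton for U_n -/

section

variable {n : ℕ}

theorem parikhVector_cons {α : Type} [DecidableEq α] (a : α) (w : List α) (b : α) :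
    parikhVector (a :: w) b = parikhVector w b + if a = b then 1 else 0 := by
  simp [parikhVector, List.count_cons]

theorem parikhVector_replicate {α : Type} [DecidableEq α] (a : α) (x : ℕ) (b : α) :
    parikhVector (List.replicate x a) b = if a = b then x else 0 := by
  simp [parikhVector, List.count_replicate]

theorem letterA_inj {i j : Fin n} : letterA i = letterA j ↔ i = j := by
  simp [letterA]

theorem letterC_inj {i j k l : Fin n} {h : i < j} {h' : k < l} :
    letterC i j h = letterC k l h' ↔ i = k ∧ j = l := by
  simp [letterC]

theorem letterA_ne_letterC {i j k : Fin n} {h : j < k} : letterA i ≠ letterC j k h := by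
  simp [letterA, letterC]

theorem letterC_ne_letterA {i j k : Fin n} {h : j < k} : letterC j k h ≠ letterA i := by
  simp [letterA, letterC]

/-- The strictly increasing sequence `p` leads from `i` to `n - 1`, and the vector `v` describes its
edges and visits only its nodes. -/
structure IsChainFrom (i : Fin n) (v : UnivLetter n → ℕ) {t : ℕ} (p : Fin (t + 1) → Fin n) :
    Prop where
  mono : StrictMono p
  first : p 0 = i
  last : (p (Fin.last t) : ℕ) + 1 = n
  le_one : ∀ (i j : Fin n) (h : i < j), v (letterC i j h) ≤ 1
  edge : ∀ (i j : Fin n) (h : i < j),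
    v (letterC i j h) = 1 ↔ ∃ s : Fin t, p s.castSucc = i ∧ p s.succ = j
  node : ∀ j, 0 < v (letterA j) → ∃ s, p s = j

/-- The vector `v` can be read by the automaton from the node `i` with counter value `c`. -/
def IsReadableFrom (i : Fin n) (c : ℕ) (v : UnivLetter n → ℕ) : Prop :=
  (∃ (t : ℕ) (p : Fin (t + 1) → Fin n), IsChainFrom i v p) ∧
    (∀ k, i ≤ k → 0 ≤ (c : ℤ) + ∑ j ∈ Finset.Iic k, (-1 : ℤ) ^ (j : ℕ) * (v (letterA j) : ℤ)) ∧
    (c : ℤ) + ∑ j : Fin n, (-1 : ℤ) ^ (j : ℕ) * (v (letterA j) : ℤ) = 0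

theorem IsChainFrom.le_of_pos {i : Fin n} {v : UnivLetter n → ℕ} {t : ℕ} {p : Fin (t + 1) → Fin n}
    (h : IsChainFrom i v p) {j : Fin n} (hj : 0 < v (letterA j)) : i ≤ j := by
  obtain ⟨s, rfl⟩ := h.node j hj
  rw [← h.first]
  exact h.mono.monotone (Fin.zero_le s)

/-- Compatibility amounts to letters a_j occurring only at nodes of the path. The prefix condition
extends to k = n - 1, where the sum is 0. -/
theorem mem_universalOneCounterSet_iff (hn : 0 < n) (v : UnivLetter n → ℕ) :
    v ∈ universalOneCounterSet n ↔ IsReadableFrom ⟨0, hn⟩ 0 v := by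
  constructor
  · rintro ⟨⟨h01, t, p, hp, hp0, hpt, hpe⟩, ⟨hb0, hb⟩, hcomp⟩
    refine ⟨⟨t, p, hp, Fin.ext hp0, hpt, fun i j h => by have := h01 i j h; omega, hpe, ?_⟩, ?_, ?_⟩
    · intro j hj
      rcases Nat.eq_zero_or_pos (j : ℕ) with h0 | h0
      · exact ⟨0, Fin.ext (by rw [hp0, h0])⟩
      · obtain ⟨i, hi, h1⟩ := (hcomp j hj).1 h0
        obtain ⟨s, -, hs⟩ := (hpe i j hi).1 h1
        exact ⟨_, hs⟩
    · intro k _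
      rw [Nat.cast_zero, zero_add]
      rcases Nat.lt_or_ge ((k : ℕ) + 1) n with h | h
      · exact hb k h
      · have : Finset.Iic k = Finset.univ := by
          ext i
          simp only [Finset.mem_Iic, Finset.mem_univ, iff_true, Fin.le_def]
          omega
        rw [this, hb0]
    · rw [Nat.cast_zero, zero_add, hb0]
  · rintro ⟨⟨t, p, hp⟩, hb, hb0⟩
    refine ⟨⟨fun i j h => by have := hp.le_one i j h; omega, t, p, hp.mono, by rw [hp.first],
      hp.last, hp.edge⟩, ⟨by simpa using hb0, fun k _ => by
        simpa using hb k (Fin.le_def.2 (Nat.zero_le _))⟩, ?_⟩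
    intro j hj
    obtain ⟨s, rfl⟩ := hp.node j hj
    constructor
    · intro h0
      rcases Fin.eq_zero_or_eq_succ s with rfl | ⟨s, rfl⟩
      · rw [hp.first] at h0; exact absurd h0 (lt_irrefl _)
      · exact ⟨p s.castSucc, hp.mono (Fin.castSucc_lt_succ), (hp.edge _ _ _).2 ⟨s, rfl, rfl⟩⟩
    · intro h0
      rcases Fin.eq_castSucc_or_eq_last s with ⟨s, rfl⟩ | rfl
      · exact ⟨p s.succ, hp.mono (Fin.castSucc_lt_succ), (hp.edge _ _ _).2 ⟨s, rfl, rfl⟩⟩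
      · rw [hp.last] at h0; exact absurd h0 (lt_irrefl _)

/-- The four counter operations, numbered. -/
def CounterOp.code : CounterOp → Fin 4
  | .inc => 0
  | .dec => 1
  | .nop => 2
  | .zeroTest => 3

theorem CounterOp.code_injective : Function.Injective CounterOp.code := by
  intro a b h
  cases a <;> cases b <;> simp_all [CounterOp.code]

instance CounterOp.finite : Finite CounterOp :=
  Finite.of_injective CounterOp.code CounterOp.code_injective

/-- The state for the node `i`. -/
def nodeState (i : Fin n) : Fin (n + 2) := ⟨i, by omega⟩

/-- The final state. -/
def finalState (n : ℕ) : Fin (n + 2) := ⟨n, by omega⟩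

theorem nodeState_ne_finalState (i : Fin n) : nodeState i ≠ finalState n := by
  intro h
  have := congrArg Fin.val h
  simp only [nodeState, finalState] at this
  omega

theorem nodeState_inj {i j : Fin n} : nodeState i = nodeState j ↔ i = j := by
  simp [nodeState, Fin.ext_iff]

/-- The operation on the counter when `a_i` is read. -/
def nodeOp (i : ℕ) : CounterOp := if i % 2 = 0 then .inc else .dec

/-- The transitions of an automaton that follows a chain and reads letters `a_i` at its node `i`. -/
inductive UnivTrans (n : ℕ) :
    Fin (n + 2) × Option (UnivLetter n) × CounterOp × Fin (n + 2) → Prop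
  | loop (i : Fin n) : UnivTrans n (nodeState i, some (letterA i), nodeOp i, nodeState i)
  | edge (i j : Fin n) (h : i < j) :
      UnivTrans n (nodeState i, some (letterC i j h), .nop, nodeState j)
  | test (i : Fin n) (h : (i : ℕ) + 1 = n) :
      UnivTrans n (nodeState i, none, .zeroTest, finalState n)

/-- A one-counter automaton for the universal one-counter set. -/
noncomputable def univOCA (n : ℕ) : OCA (UnivLetter n) (Fin (n + 2)) where
  trans := (Set.toFinite {x | UnivTrans n x}).toFinset
  -- States 0, …, n - 1 are the nodes and n is final; state n + 1 has no transitions and only fills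
  -- up the count n + 2.
  start := ⟨0, by omega⟩
  accept := {finalState n}

theorem mem_univOCA_trans {x : Fin (n + 2) × Option (UnivLetter n) × CounterOp × Fin (n + 2)} :
    x ∈ (univOCA n).trans ↔ UnivTrans n x := by
  simp [univOCA]

theorem nodeOp_step {i c d : ℕ} : (nodeOp i).Step c d ↔ (d : ℤ) = c + (-1) ^ i := by
  unfold nodeOp
  rcases Nat.mod_two_eq_zero_or_one i with h | h
  · rw [if_pos h, (Nat.even_iff.2 h).neg_one_pow]
    simp only [CounterOp.Step]
    omega
  · rw [if_neg (by omega), (Nat.odd_iff.2 h).neg_one_pow]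
    simp only [CounterOp.Step]
    omega

theorem isReadableFrom_last {i : Fin n} (h : (i : ℕ) + 1 = n) :
    IsReadableFrom i 0 (parikhVector ([] : List (UnivLetter n))) := by
  refine ⟨⟨0, fun _ => i, ⟨?_, rfl, h, ?_, ?_, ?_⟩⟩, ?_, ?_⟩
  · intro a b hab; omega
  · intro i j h; simp [parikhVector]
  · intro i j h
    simp [parikhVector]
  · intro j hj; simp [parikhVector] at hj
  · intro k _; simp [parikhVector]
  · simp [parikhVector]

theorem sum_add_single (T : Finset (Fin n)) (i : Fin n) (w : List (UnivLetter n)) :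
    ∑ j ∈ T, (-1 : ℤ) ^ (j : ℕ) * (parikhVector (letterA i :: w) (letterA j) : ℤ) =
      (∑ j ∈ T, (-1 : ℤ) ^ (j : ℕ) * (parikhVector w (letterA j) : ℤ)) +
        if i ∈ T then (-1 : ℤ) ^ (i : ℕ) else 0 := by
  simp only [parikhVector_cons, letterA_inj, Nat.cast_add, mul_add, Finset.sum_add_distrib,
    Nat.cast_ite, Nat.cast_one, Nat.cast_zero, mul_ite, mul_one, mul_zero, Finset.sum_ite_eq]

theorem IsReadableFrom.loop {i : Fin n} {c c' : ℕ} {w : List (UnivLetter n)}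
    (h : IsReadableFrom i c' (parikhVector w)) (hc : (c' : ℤ) = c + (-1) ^ (i : ℕ)) :
    IsReadableFrom i c (parikhVector (letterA i :: w)) := by
  obtain ⟨⟨t, p, hp⟩, hb, hb0⟩ := h
  refine ⟨⟨t, p, hp.mono, hp.first, hp.last, ?_, ?_, ?_⟩, ?_, ?_⟩
  · intro k l hkl
    rw [parikhVector_cons, if_neg letterA_ne_letterC]
    exact hp.le_one k l hkl
  · intro k l hkl
    rw [parikhVector_cons, if_neg letterA_ne_letterC]
    exact hp.edge k l hkl
  · intro j hj
    simp only [parikhVector_cons, letterA_inj] at hj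
    by_cases hij : i = j
    · exact ⟨0, hp.first.trans hij⟩
    · rw [if_neg hij] at hj
      exact hp.node j hj
  · intro k hk
    rw [sum_add_single, if_pos (Finset.mem_Iic.2 hk)]
    have := hb k hk
    linarith
  · rw [sum_add_single, if_pos (Finset.mem_univ _)]
    linarith

/-- The new edge starts below all nodes of the old chain, so it was not used before. No letter a_l
with l < j occurs, so partial sums before j reduce to the counter value. -/
theorem IsReadableFrom.edge {i j : Fin n} (hij : i < j) {c : ℕ} {w : List (UnivLetter n)}
    (h : IsReadableFrom j c (parikhVector w)) :
    IsReadableFrom i c (parikhVector (letterC i j hij :: w)) := by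
  obtain ⟨⟨t, p, hp⟩, hb, hb0⟩ := h
  have hA : ∀ k, parikhVector (letterC i j hij :: w) (letterA k) = parikhVector w (letterA k) := by
    intro k
    rw [parikhVector_cons, if_neg letterC_ne_letterA, add_zero]
  have hjp : ∀ s, j ≤ p s := fun s => by
    rw [← hp.first]
    exact hp.mono.monotone (Fin.zero_le s)
  refine ⟨⟨t + 1, Fin.cons i p, ?_, rfl, ?_, ?_, ?_, ?_⟩, ?_, ?_⟩
  · rw [Fin.strictMono_iff_lt_succ]
    intro s
    refine Fin.cases ?_ (fun s => ?_) s
    · rw [Fin.castSucc_zero, Fin.cons_zero, Fin.cons_succ, hp.first]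
      exact hij
    · rw [← Fin.succ_castSucc, Fin.cons_succ, Fin.cons_succ]
      exact hp.mono Fin.castSucc_lt_succ
  · rw [← Fin.succ_last, Fin.cons_succ]
    exact hp.last
  · intro k l hkl
    simp only [parikhVector_cons, letterC_inj]
    split_ifs with heq
    · obtain ⟨rfl, rfl⟩ := heq
      have h1 := hp.le_one i j hkl
      have h2 : ¬ parikhVector w (letterC i j hkl) = 1 := by
        rw [hp.edge]
        rintro ⟨s, hs, -⟩
        have := hjp s.castSucc
        rw [hs] at this
        exact absurd hij (not_lt.2 this)
      omega
    · exact hp.le_one k l hkl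
  · intro k l hkl
    simp only [parikhVector_cons, letterC_inj]
    have hrest : (∃ s : Fin (t + 1), (Fin.cons i p : Fin (t + 1 + 1) → Fin n) s.castSucc = k ∧
        (Fin.cons i p : Fin (t + 1 + 1) → Fin n) s.succ = l) ↔
        (i = k ∧ j = l) ∨ ∃ s : Fin t, p s.castSucc = k ∧ p s.succ = l := by
      constructor
      · rintro ⟨s, hs1, hs2⟩
        rcases Fin.eq_zero_or_eq_succ s with rfl | ⟨s, rfl⟩
        · left
          rw [Fin.castSucc_zero, Fin.cons_zero] at hs1
          rw [Fin.cons_succ, hp.first] at hs2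
          exact ⟨hs1, hs2⟩
        · right
          rw [← Fin.succ_castSucc, Fin.cons_succ] at hs1
          rw [Fin.cons_succ] at hs2
          exact ⟨s, hs1, hs2⟩
      · rintro (⟨rfl, rfl⟩ | ⟨s, hs1, hs2⟩)
        · exact ⟨0, rfl, by rw [Fin.cons_succ, hp.first]⟩
        · exact ⟨s.succ, by rw [← Fin.succ_castSucc, Fin.cons_succ, hs1],
            by rw [Fin.cons_succ, hs2]⟩
    rw [hrest, ← hp.edge k l hkl]
    split_ifs with heq
    · obtain ⟨rfl, rfl⟩ := heq
      have h1 := hp.le_one i j hkl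
      have h2 : ¬ parikhVector w (letterC i j hkl) = 1 := by
        rw [hp.edge]
        rintro ⟨s, hs, -⟩
        have := hjp s.castSucc
        rw [hs] at this
        exact absurd hij (not_lt.2 this)
      simp only [and_self, true_or, iff_true]
      omega
    · simp only [heq, false_or, add_zero]
  · intro k hk
    rw [hA] at hk
    obtain ⟨s, hs⟩ := hp.node k hk
    exact ⟨s.succ, by rw [Fin.cons_succ, hs]⟩
  · intro k hk
    simp only [hA]
    rcases le_or_gt j k with hjk | hjk
    · exact hb k hjk
    · rw [Finset.sum_eq_zero]
      · positivity
      · intro l hl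
        have : parikhVector w (letterA l) = 0 := by
          by_contra hne
          have h1 := hp.le_of_pos (Nat.pos_of_ne_zero hne)
          have h2 := Finset.mem_Iic.1 hl
          exact absurd hjk (not_lt.2 (h1.trans h2))
        rw [this, Nat.cast_zero, mul_zero]
  · simp only [hA]
    exact hb0

/-- Soundness, by induction on the run from its end: the final state is entered only by the zero
test and has no outgoing transition. -/
theorem isReadableFrom_of_run {q r : Fin (n + 2)} {c d : ℕ} {w : List (UnivLetter n)}
    (h : (univOCA n).Run q c w r d) (hr : r = finalState n) :
    (q = finalState n → w = []) ∧ ∀ i : Fin n, q = nodeState i → IsReadableFrom i c (parikhVector w)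
    := by
  induction h with
  | nil q c =>
    exact ⟨fun _ => rfl, fun i hi => absurd (hi.symm.trans hr) (nodeState_ne_finalState i)⟩
  | cons q q' r c c' d a o w htr hstep hrun ih =>
    obtain ⟨ih1, ih2⟩ := ih hr
    rw [mem_univOCA_trans] at htr
    cases htr with
    | loop i =>
      refine ⟨fun h => absurd h (nodeState_ne_finalState i), fun j hj => ?_⟩
      rw [nodeState_inj] at hj
      subst hj
      exact (ih2 i rfl).loop (nodeOp_step.1 hstep)
    | edge i j hij =>
      refine ⟨fun h => absurd h (nodeState_ne_finalState i), fun k hk => ?_⟩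
      rw [nodeState_inj] at hk
      subst hk
      have hc : c' = c := hstep
      subst hc
      exact (ih2 j rfl).edge hij
    | test i hi =>
      refine ⟨fun h => absurd h (nodeState_ne_finalState i), fun k hk => ?_⟩
      rw [nodeState_inj] at hk
      subst hk
      obtain ⟨rfl, rfl⟩ := hstep
      rw [ih1 rfl]
      exact isReadableFrom_last hi

/-- The counter moves in one direction, so it suffices that both end values are nonnegative. -/
theorem run_replicate (i : Fin n) (x : ℕ) {c c' d : ℕ} {w : List (UnivLetter n)}
    {r : Fin (n + 2)} (h : (univOCA n).Run (nodeState i) c' w r d)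
    (hc : (c' : ℤ) = c + (-1) ^ (i : ℕ) * x) :
    (univOCA n).Run (nodeState i) c (List.replicate x (letterA i) ++ w) r d := by
  induction x generalizing c with
  | zero =>
    have : c' = c := by simpa using hc
    subst this
    exact h
  | succ x ih =>
    have hstep : ∃ c₁ : ℕ, (c₁ : ℤ) = c + (-1) ^ (i : ℕ) := by
      rcases neg_one_pow_eq_or ℤ (i : ℕ) with h1 | h1 <;> rw [h1] at hc ⊢ <;> push_cast at hc
      · exact ⟨c + 1, by push_cast; ring⟩
      · exact ⟨c - 1, by omega⟩
    obtain ⟨c₁, hc₁⟩ := hstep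
    have h2 := ih (c := c₁) (by rw [hc₁, hc]; push_cast; ring)
    exact OCA.Run.cons _ _ _ c c₁ _ (some (letterA i)) _ _
      (mem_univOCA_trans.2 (UnivTrans.loop i)) (nodeOp_step.2 hc₁) h2

/-- Completeness: the run is built backwards from n - 1. On arrival at a node the counter holds the
alternating sum over the letters strictly below it. -/
theorem IsChainFrom.exists_run {i : Fin n} {v : UnivLetter n → ℕ} {t : ℕ} {p : Fin (t + 1) → Fin n}
    (hp : IsChainFrom i v p)
    (hb : ∀ s, 0 ≤ ∑ j ∈ Finset.Iio (p s), (-1 : ℤ) ^ (j : ℕ) * (v (letterA j) : ℤ))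
    (hb0 : ∑ j : Fin n, (-1 : ℤ) ^ (j : ℕ) * (v (letterA j) : ℤ) = 0) (s : Fin (t + 1)) :
    ∃ (c : ℕ) (w : List (UnivLetter n)),
      (c : ℤ) = ∑ j ∈ Finset.Iio (p s), (-1 : ℤ) ^ (j : ℕ) * (v (letterA j) : ℤ) ∧
      (univOCA n).Run (nodeState (p s)) c w (finalState n) 0 ∧
      (∀ j, parikhVector w (letterA j) = if p s ≤ j then v (letterA j) else 0) ∧
      ∀ j k h, parikhVector w (letterC j k h) = if p s ≤ j then v (letterC j k h) else 0 := by
  have hIic : ∀ k : Fin n, ∑ j ∈ Finset.Iic k, (-1 : ℤ) ^ (j : ℕ) * (v (letterA j) : ℤ) =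
      ∑ j ∈ Finset.Iio k, (-1 : ℤ) ^ (j : ℕ) * (v (letterA j) : ℤ) +
        (-1 : ℤ) ^ (k : ℕ) * (v (letterA k) : ℤ) := by
    intro k
    rw [← Finset.Iio_insert, Finset.sum_insert (by simp), add_comm]
  induction s using Fin.reverseInduction with
  | last =>
    have hlast := hp.last
    refine ⟨_, List.replicate (v (letterA (p (Fin.last t)))) (letterA (p (Fin.last t))) ++ [],
      Int.toNat_of_nonneg (hb _), run_replicate _ _ (c' := 0) ?_ ?_, ?_, ?_⟩
    · exact OCA.Run.cons _ _ _ 0 0 0 none .zeroTest []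
        (mem_univOCA_trans.2 (UnivTrans.test _ hlast)) ⟨rfl, rfl⟩ (OCA.Run.nil _ _)
    · rw [Int.toNat_of_nonneg (hb _), ← hIic]
      have : Finset.Iic (p (Fin.last t)) = Finset.univ := by
        ext j
        simp only [Finset.mem_Iic, Finset.mem_univ, iff_true, Fin.le_def]
        omega
      rw [this, hb0, Nat.cast_zero]
    · intro j
      rw [List.append_nil, parikhVector_replicate]
      have : p (Fin.last t) ≤ j ↔ p (Fin.last t) = j := by
        rw [Fin.le_def, Fin.ext_iff]; omega
      simp only [letterA_inj, this]
      split_ifs with h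
      · rw [h]
      · rfl
    · intro j k h
      rw [List.append_nil, parikhVector_replicate, if_neg letterA_ne_letterC, if_neg]
      rw [Fin.le_def]
      have := Fin.lt_def.1 h
      omega
  | cast s ih =>
    obtain ⟨c, w, hc, hrun, hwA, hwC⟩ := ih
    have hlt : p s.castSucc < p s.succ := hp.mono Fin.castSucc_lt_succ
    have hgap : ∀ r, p s.castSucc < p r → p s.succ ≤ p r := by
      intro r hr
      rw [hp.mono.lt_iff_lt] at hr
      exact hp.mono.monotone (Fin.castSucc_lt_iff_succ_le.1 hr)
    -- No letters sit between consecutive nodes, so the counter after the loop at one node is the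
    -- value required on arrival at the next.
    have hzero : ∀ j, p s.castSucc < j → ¬ p s.succ ≤ j → v (letterA j) = 0 := by
      intro j h1 h2
      by_contra hne
      obtain ⟨r, rfl⟩ := hp.node j (Nat.pos_of_ne_zero hne)
      exact h2 (hgap r h1)
    have hcount := hb s.castSucc
    refine ⟨_, List.replicate (v (letterA (p s.castSucc))) (letterA (p s.castSucc)) ++
      (letterC _ _ hlt :: w), Int.toNat_of_nonneg hcount, run_replicate _ _ (c' := c) ?_ ?_, ?_, ?_⟩
    · exact OCA.Run.cons _ _ _ c c 0 (some (letterC _ _ hlt)) .nop w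
        (mem_univOCA_trans.2 (UnivTrans.edge _ _ hlt)) rfl hrun
    · rw [Int.toNat_of_nonneg hcount, ← hIic, hc]
      symm
      refine Finset.sum_subset ?_ ?_
      · intro j hj
        exact Finset.mem_Iio.2 (lt_of_le_of_lt (Finset.mem_Iic.1 hj) hlt)
      · intro j hj hj'
        rw [Finset.mem_Iio] at hj
        rw [Finset.mem_Iic, not_le] at hj'
        rw [hzero j hj' (not_le.2 hj), Nat.cast_zero, mul_zero]
    · intro j
      rw [parikhVector_append, parikhVector_replicate, parikhVector_cons,
        if_neg letterC_ne_letterA, hwA]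
      simp only [letterA_inj]
      rcases lt_trichotomy (p s.castSucc) j with h | h | h
      · rw [if_neg h.ne, if_pos h.le]
        split_ifs with h'
        · simp
        · simp [hzero j h h']
      · subst h
        rw [if_pos rfl, if_neg (not_le.2 hlt), if_pos le_rfl]
        simp
      · rw [if_neg h.ne', if_neg (not_le.2 h), if_neg (not_le.2 (h.trans hlt))]
    · intro j k h
      rw [parikhVector_append, parikhVector_replicate, if_neg letterA_ne_letterC,
        parikhVector_cons, hwC]
      simp only [letterC_inj]
      have h1 := hp.le_one j k h
      have h2 := hp.edge j k h
      rcases lt_trichotomy (p s.castSucc) j with hj | hj | hj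
      · have hne : ¬(p s.castSucc = j ∧ p s.succ = k) := fun h => hj.ne h.1
        rw [if_neg hne, if_pos hj.le]
        split_ifs with h'
        · simp
        · have : ¬ v (letterC j k h) = 1 := by
            rw [h2]
            rintro ⟨r, rfl, -⟩
            exact h' (hgap _ hj)
          omega
      · subst hj
        rw [if_neg (not_le.2 hlt), if_pos le_rfl]
        by_cases hk : p s.succ = k
        · rw [if_pos ⟨rfl, hk⟩, h2.2 ⟨s, rfl, hk⟩]
        · have : ¬ v (letterC (p s.castSucc) k h) = 1 := by
            rw [h2]
            rintro ⟨r, hr1, hr2⟩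
            have := Fin.castSucc_injective _ (hp.mono.injective hr1)
            subst this
            exact hk hr2
          have hne : ¬(p s.castSucc = p s.castSucc ∧ p s.succ = k) := fun h => hk h.2
          rw [if_neg hne]
          omega
      · have hne : ¬(p s.castSucc = j ∧ p s.succ = k) := fun h => hj.ne' h.1
        rw [if_neg hne, if_neg (not_le.2 hj), if_neg (not_le.2 (hj.trans hlt))]

theorem parikhImage_univOCA (hn : 2 ≤ n) :
    parikhImage (univOCA n).accepts = universalOneCounterSet n := by
  ext v
  rw [mem_universalOneCounterSet_iff (by omega)]
  constructor
  · rintro ⟨w, ⟨q, hq, d, hrun⟩, rfl⟩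
    exact (isReadableFrom_of_run hrun hq).2 ⟨0, by omega⟩ rfl
  · rintro ⟨⟨t, p, hp⟩, hb, hb0⟩
    rw [Nat.cast_zero, zero_add] at hb0
    obtain ⟨c, w, hc, hrun, hwA, hwC⟩ := hp.exists_run (fun s => by
      rcases Nat.eq_zero_or_pos (p s : ℕ) with h0 | h0
      · rw [Finset.sum_eq_zero]
        intro j hj
        have := Fin.lt_def.1 (Finset.mem_Iio.1 hj)
        omega
      · have := hb ⟨p s - 1, by omega⟩ (Fin.le_def.2 (Nat.zero_le _))
        rw [Nat.cast_zero, zero_add] at this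
        have e : Finset.Iio (p s) = Finset.Iic ⟨p s - 1, by omega⟩ := by
          ext j
          simp only [Finset.mem_Iio, Finset.mem_Iic, Fin.lt_def, Fin.le_def]
          omega
        rwa [e]) hb0 0
    have hp0 : ∀ j, p 0 ≤ j := fun j => by
      rw [hp.first]; exact Fin.le_def.2 (Nat.zero_le _)
    have hc0 : c = 0 := by
      rw [Finset.sum_eq_zero] at hc
      · exact_mod_cast hc
      · intro j hj
        exact absurd (hp0 j) (not_le.2 (Finset.mem_Iio.1 hj))
    subst hc0
    refine ⟨w, ⟨finalState n, rfl, 0, ?_⟩, ?_⟩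
    · rw [hp.first] at hrun
      exact hrun
    · funext a
      rcases a with ⟨⟨i, j⟩, h⟩ | i
      · exact (hwC i j h).trans (if_pos (hp0 i))
      · exact (hwA i).trans (if_pos (hp0 i))

end

/-! ### No polynomial translation -/

theorem card_univLetter_le (n : ℕ) : Fintype.card (UnivLetter n) ≤ n * n + n := by
  rw [Fintype.card_sum, Fintype.card_fin]
  refine Nat.add_le_add_right ?_ n
  exact (Fintype.card_subtype_le _).trans (by simp)

/-- A crude bound; only the fixed degree matters. Transitions are counted as quadruples of a state,
an optional letter, one of four operations and a state. -/
theorem univOCA_size_le {n : ℕ} (hn : 2 ≤ n) : (univOCA n).size ≤ n ^ 10 := by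
  have h1 := card_univLetter_le n
  have h2 : (univOCA n).trans.card ≤
      (n + 2) * ((Fintype.card (UnivLetter n) + 1) * (4 * (n + 2))) := by
    refine (Finset.card_le_card_of_injOn (t := Finset.univ)
      (fun x => (x.1, x.2.1, x.2.2.1.code, x.2.2.2)) (fun _ _ => Finset.mem_coe.2 (Finset.mem_univ _))
      ?_).trans ?_
    · rintro ⟨q, a, o, q'⟩ - ⟨r, b, o', r'⟩ - h
      simp only [Prod.mk.injEq] at h
      obtain ⟨rfl, rfl, h, rfl⟩ := h
      rw [CounterOp.code_injective h]
    · rw [Finset.card_univ, Fintype.card_prod, Fintype.card_prod, Fintype.card_prod,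
        Fintype.card_option, Fintype.card_fin, Fintype.card_fin]
  have h3 : Fintype.card (UnivLetter n) + 1 ≤ 2 * (n * n) := by nlinarith
  have h4 : (univOCA n).trans.card ≤ 2 * n * (2 * (n * n) * (4 * (2 * n))) :=
    h2.trans (Nat.mul_le_mul (by omega)
      (Nat.mul_le_mul h3 (Nat.mul_le_mul_left _ (by omega))))
  have h5 : 4 ≤ n * n := Nat.mul_le_mul hn hn
  have h6 : 2 * n + 2 * (n * n) ≤ 8 * n ^ 4 := by
    have e : n ^ 4 = (n * n) * (n * n) := by ring
    nlinarith
  have h7 : 64 ≤ n ^ 6 := by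
    calc 64 = 2 ^ 6 := by norm_num
      _ ≤ n ^ 6 := Nat.pow_le_pow_left hn 6
  calc (univOCA n).size = (n + 2) + Fintype.card (UnivLetter n) + (univOCA n).trans.card := by
        simp [OCA.size]
    _ ≤ 2 * n + 2 * (n * n) + 2 * n * (2 * (n * n) * (4 * (2 * n))) := by omega
    _ ≤ 8 * n ^ 4 + 32 * n ^ 4 := Nat.add_le_add h6 (le_of_eq (by ring))
    _ ≤ 64 * n ^ 4 := by omega
    _ ≤ n ^ 6 * n ^ 4 := Nat.mul_le_mul_right _ h7
    _ = n ^ 10 := by ring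

theorem Polynomial.eval_le_eval_one_mul_pow (P : Polynomial ℕ) {x y : ℕ} (hxy : x ≤ y)
    (hy : 1 ≤ y) : P.eval x ≤ P.eval 1 * y ^ P.natDegree := by
  rw [Polynomial.eval_eq_sum_range, Polynomial.eval_eq_sum_range, Finset.sum_mul]
  refine Finset.sum_le_sum fun i hi => ?_
  rw [one_pow, mul_one]
  refine Nat.mul_le_mul_left _ ((Nat.pow_le_pow_left hxy i).trans ?_)
  exact Nat.pow_le_pow_right hy (by have := Finset.mem_range.1 hi; omega)

theorem eventually_le_sqrt_div_log (B : ℝ) :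
    ∀ᶠ n : ℕ in Filter.atTop, B ≤ Real.sqrt (Real.log n / Real.log (Real.log n)) := by
  have h1 : ∀ᶠ x : ℝ in Filter.atTop, B ≤ Real.sqrt (x / Real.log x) := by
    filter_upwards [Real.isLittleO_log_id_atTop.bound (c := 1 / (B ^ 2 + 1)) (by positivity),
      Filter.eventually_gt_atTop (Real.exp 1)] with x hx hx1
    have hx0 : 0 < x := lt_trans (Real.exp_pos 1) hx1
    have hlog : 0 < Real.log x := by
      have := Real.log_lt_log (Real.exp_pos 1) hx1
      rw [Real.log_exp] at this
      linarith
    rw [Real.norm_of_nonneg hlog.le, id, Real.norm_of_nonneg hx0.le, one_div_mul_eq_div,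
      le_div_iff₀ (by positivity)] at hx
    refine Real.le_sqrt_of_sq_le ?_
    rw [le_div_iff₀ hlog]
    nlinarith
  exact (Real.tendsto_log_atTop.comp tendsto_natCast_atTop_atTop).eventually h1

theorem not_exists_polynomial_translation :
    ¬ ∃ P : Polynomial ℕ,
      ∀ (α Q : Type) [Fintype α] [DecidableEq α] [Fintype Q] (A : OCA α Q),
        ∃ (S : Type) (_ : Fintype S) (M : NFA α S),
          parikhImage M.accepts = parikhImage A.accepts ∧ Fintype.card S ≤ P.eval A.size := by
  rintro ⟨P, hP⟩
  obtain ⟨c, hc, N, hN⟩ := nfa_lower_bound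
  -- On automata of size at most n^10, P is at most P(1) n^D, while the lower bound eventually
  -- exceeds n^(D+1).
  set D := 10 * P.natDegree with hD
  obtain ⟨n₀, hn₀⟩ := Filter.eventually_atTop.1 (eventually_le_sqrt_div_log ((D + 1) / c))
  -- Even, beyond both thresholds, and larger than P(1), which contradicts the inequality n ≤ P(1)
  -- derived at the end.
  obtain ⟨n, hn⟩ : ∃ n, n = 2 * (N + n₀ + P.eval 1 + 1) := ⟨_, rfl⟩
  obtain ⟨S, _, M, hM, hS⟩ := hP (UnivLetter n) (Fin (n + 2)) (univOCA n)
  rw [parikhImage_univOCA (by omega)] at hM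
  have h1 := hN n (by omega) ⟨N + n₀ + P.eval 1 + 1, by omega⟩ S M hM
  have h2 := hn₀ n (by omega)
  rw [div_le_iff₀ hc, mul_comm] at h2
  have hn1 : (1 : ℝ) ≤ n := by exact_mod_cast (show 1 ≤ n by omega)
  have h3 : (n : ℝ) ^ (D + 1) ≤ Fintype.card S := by
    refine le_trans ?_ h1
    rw [← Real.rpow_natCast]
    exact Real.rpow_le_rpow_of_exponent_le hn1 (by push_cast; exact h2)
  have h4 : n ^ (D + 1) ≤ P.eval 1 * n ^ D := by
    have h5 : n ^ (D + 1) ≤ Fintype.card S := by exact_mod_cast h3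
    refine h5.trans (hS.trans ?_)
    have h6 := P.eval_le_eval_one_mul_pow (univOCA_size_le (n := n) (by omega))
      (Nat.one_le_pow _ _ (by omega))
    rwa [← pow_mul] at h6
  have h7 : n ≤ P.eval 1 := by
    rw [pow_succ, mul_comm] at h4
    exact Nat.le_of_mul_le_mul_right h4 (by have : 0 < n := by omega
                                            positivity)
  omega

theorem mainTheorem2 :
    -- every NFA for `U_n` has `n ^ Ω(√(log n / log log n))` states
    (∃ c : ℝ, 0 < c ∧ ∃ N : ℕ, ∀ n : ℕ, N ≤ n → Even n →
      ∀ (S : Type) [Fintype S] (M : NFA (UnivLetter n) S),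
        parikhImage M.accepts = universalOneCounterSet n →
        (n : ℝ) ^ (c * Real.sqrt (Real.log n / Real.log (Real.log n))) ≤ (Fintype.card S : ℝ)) ∧
    -- `U_n` is the Parikh image of the language of a one-counter automaton with `n + 2` states
    (∀ n : ℕ, 2 ≤ n → Even n →
      ∃ A : OCA (UnivLetter n) (Fin (n + 2)),
        parikhImage A.accepts = universalOneCounterSet n) ∧
    -- there is no polynomial translation from one-counter automata to Parikh-equivalent NFA
    ¬ ∃ P : Polynomial ℕ,
      ∀ (α Q : Type) [Fintype α] [DecidableEq α] [Fintype Q] (A : OCA α Q),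
        ∃ (S : Type) (_ : Fintype S) (M : NFA α S),
          parikhImage M.accepts = parikhImage A.accepts ∧ Fintype.card S ≤ P.eval A.size :=
  ⟨nfa_lower_bound, fun n hn _ => ⟨univOCA n, parikhImage_univOCA hn⟩,
    not_exists_polynomial_translation⟩
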